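/- A TSP instance is a finite complete undirected graph $G=(V,E)$ with edge weights $c$; its size is $n=|V|$, a tour is a Hamiltonian cycle of $G$, and the weight of a tour is the sum of its edge weights. The instance is metric if $c(xz)\le c(xy)+c(yz)$ for all distinct $x,y,z\in V$. A 2.5-swap on a tour $\tau$ removes a set $E_1$ of edges of $\tau$ and adds a set $E_2\subseteq E$ with $|E_2|=|E_1|$, where either $|E_1|=2$, or $E_1$ contains exactly three edges, two of which are incident; it is improving if the result is a tour of strictly smaller weight. The 2.5-opt algorithm starts with some tour and, as long as one exists, performs an improving 2.5-swap (selected by a pivot rule); it stops at a tour that admits no improving 2.5-swap. Theorem. The 2.5-opt algorithm for the TSP has the all-exp property: there are constants $c_0>1$ and $K>0$ and pairs of a TSP instance of arbitrarily large size and an initial tour such that, if $n$ is the size of the instance, then every execution of the 2.5-opt algorithm from the initial tour needs at least $K\,c_0^{\,n}$ iterations to reach a local optimum, whatever the pivot rule. The same holds for the metric TSP. Both statements hold for real weights as well as when only integer weights are allowed. -/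

import Mathlib

/-- A local search (minimization) problem: instances with a size, for each instance a finite set of
feasible solutions, an objective with values in a linear order `R`, and a neighborhood of each
solution. -/
structure LocalSearchProblem.{u, v} (R : Type) [LinearOrder R] where
  /-- the instances -/
  Inst : Type u
  /-- the size of an instance -/
  size : Inst → ℕ
  /-- the feasible solutions of an instance -/
  Sol : Inst → Type v
  finite_sol : ∀ I, Finite (Sol I)
  /-- the objective function, to be minimized -/
  obj : ∀ I, Sol I → R
  /-- the neighborhood of a solution -/
  nbhd : ∀ I, Sol I → Set (Sol I)

namespace LocalSearchProblem

universe u v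

variable {R : Type} [LinearOrder R] (P : LocalSearchProblem.{u, v} R)

/-- `s` is locally optimal: no neighbor has a better objective value. -/
def IsLocalOpt (I : P.Inst) (s : P.Sol I) : Prop :=
  ∀ s' ∈ P.nbhd I s, P.obj I s ≤ P.obj I s'

/-- One iteration of the standard local search algorithm (an edge of the transition graph):
move to a neighbor with strictly better objective value. -/
def Step (I : P.Inst) (s s' : P.Sol I) : Prop :=
  s' ∈ P.nbhd I s ∧ P.obj I s' < P.obj I s

/-- `x 0, x 1, …, x l` is a complete execution of the standard local search algorithm (under some
pivot rule) from the initial solution `s`: it makes `l` iterations and ends in a local optimum. -/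
def IsExecution (I : P.Inst) (s : P.Sol I) (l : ℕ) (x : ℕ → P.Sol I) : Prop :=
  x 0 = s ∧ (∀ i < l, P.Step I (x i) (x (i + 1))) ∧ P.IsLocalOpt I (x l)

/-- The all-exp property: for some constants `c > 1` and `K > 0` there are pairs of an instance of
arbitrarily large size `n` and an initial solution from which every execution of the standard local
search algorithm, whatever the pivot rule, needs at least `K * c ^ n` iterations. -/
def AllExp : Prop :=
  ∃ c : ℝ, 1 < c ∧ ∃ K : ℝ, 0 < K ∧ ∀ m : ℕ, ∃ I : P.Inst, m ≤ P.size I ∧ ∃ s : P.Sol I,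
    ∀ (l : ℕ) (x : ℕ → P.Sol I), P.IsExecution I s l x → K * c ^ P.size I ≤ (l : ℝ)

/-- The same problem with a smaller set of instances. -/
def restrict (D : Set P.Inst) : LocalSearchProblem.{u, v} R where
  Inst := D
  size I := P.size I.1
  Sol I := P.Sol I.1
  finite_sol I := P.finite_sol I.1
  obj I := P.obj I.1
  nbhd I := P.nbhd I.1

end LocalSearchProblem

/-- A TSP instance: the complete graph on a finite vertex set `V` with edge weights in `R`.
The edges are the non-diagonal elements of `Sym2 V`; the values of `c` on the diagonal play
no role. -/
structure TSPInstance (R : Type) where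
  /-- the vertices -/
  V : Type
  [fintypeV : Fintype V]
  [decEqV : DecidableEq V]
  /-- the edge weights -/
  c : Sym2 V → R

namespace TSPInstance

attribute [instance] TSPInstance.fintypeV TSPInstance.decEqV

variable {R : Type}

/-- A tour, given by its edge set: the edge set of a Hamiltonian cycle of the complete graph. -/
def IsTour {V : Type} [DecidableEq V] (T : Finset (Sym2 V)) : Prop :=
  ∃ (v : V) (p : (⊤ : SimpleGraph V).Walk v v), p.IsHamiltonianCycle ∧ p.edges.toFinset = T

/-- The weight of a set of edges. -/
def weight [AddCommMonoid R] (I : TSPInstance R) (T : Finset (Sym2 I.V)) : R :=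
  ∑ e ∈ T, I.c e

/-- The edge weights satisfy the triangle inequality. -/
def IsMetric [AddCommMonoid R] [LinearOrder R] (I : TSPInstance R) : Prop :=
  ∀ x y z : I.V, x ≠ y → y ≠ z → x ≠ z → I.c s(x, z) ≤ I.c s(x, y) + I.c s(y, z)

/-- `(E₁, E₂)` is a swap: two sets of edges of the complete graph with the same cardinality. -/
def IsSwap {V : Type} (E₁ E₂ : Finset (Sym2 V)) : Prop :=
  (∀ e ∈ E₁, ¬ e.IsDiag) ∧ (∀ e ∈ E₂, ¬ e.IsDiag) ∧ E₁.card = E₂.card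

/-- `(E₁, E₂)` is a 2.5-swap: a swap where `E₁` consists of two edges, or of three edges two of
which are incident. -/
def IsTwoHalfSwap {V : Type} (E₁ E₂ : Finset (Sym2 V)) : Prop :=
  IsSwap E₁ E₂ ∧
    (E₁.card = 2 ∨ (E₁.card = 3 ∧ ∃ e ∈ E₁, ∃ f ∈ E₁, e ≠ f ∧ ∃ v : V, v ∈ e ∧ v ∈ f))

/-- The tour `T'` is obtained from `T` by an improving 2.5-swap. -/
def ImprovingTwoHalfSwap [AddCommMonoid R] [LinearOrder R] (I : TSPInstance R)
    (T T' : Finset (Sym2 I.V)) : Prop :=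
  (∃ E₁ E₂ : Finset (Sym2 I.V), IsTwoHalfSwap E₁ E₂ ∧ E₁ ⊆ T ∧ T' = (T \ E₁) ∪ E₂) ∧
    I.weight T' < I.weight T

end TSPInstance

/-- The local search problem TSP/2.5-opt with weights in `R`; its standard local search algorithm
is the 2.5-opt algorithm. The size of an instance is its number of vertices. -/
def tspTwoHalfOpt (R : Type) [AddCommMonoid R] [LinearOrder R] : LocalSearchProblem.{1, 0} R where
  Inst := TSPInstance R
  size I := Fintype.card I.V
  Sol I := {T : Finset (Sym2 I.V) // TSPInstance.IsTour T}
  finite_sol _ := inferInstance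
  obj I T := I.weight T.1
  nbhd I T := {T' | I.ImprovingTwoHalfSwap T.1 T'.1}

/-- TSP/2.5-opt restricted to the instances that satisfy the triangle inequality. -/
def metricTspTwoHalfOpt (R : Type) [AddCommMonoid R] [LinearOrder R] :
    LocalSearchProblem.{1, 0} R :=
  (tspTwoHalfOpt R).restrict {I : TSPInstance R | I.IsMetric}

/-! The proof turns 2.5-opt into a game of tokens. The vertices are tokens and two fixed backbone
vertices per slot. Each token may sit in one of two slots, and a configuration gives the tour that
visits the slots cyclically and the vertices of a slot by increasing position. An edge inside a slot
costs a large constant `A` times its length plus a small, freely chosen perturbation; edges between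
consecutive slots are very cheap, all others very expensive. The graph with slots as vertices and
tokens as edges has no cycle of length at most four, so the edges of a profitable exchange cannot
spread over several slots unless a token moves to its other place. Hence improving swaps are token
moves (`exists_eq_tour_update`), and token moves are 2.5-swaps (`exists_swap_update`). Up to a
constant, the weight of a tour is the sum of its perturbations (`sum_tour_eq`), so 2.5-opt is
single-flip descent for an energy of interacting tokens.

The energy describes a tower of `n + 1` rings of 21 tokens. A price on surplus domain walls confines
each ring to a cycle of 42 states. Every step around the cycle gains one unit, except that passing
from state 18 to 19 means climbing a barrier of `2 * height i + 41`. Ring `i + 1` drops by `height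
(i + 1) = 2 * height i + 42` twice per turn, and the couplings store each drop until ring `i` uses
it to cross its barrier, again with a net gain of one. So one turn of a ring entails two turns of
the ring below.

The pivot rule has no influence: from a valid state, each improving flip is a forward step that
gains exactly one (`Valid.step`, `Valid.back`), and the only dead end has all rings in state 18
(`eq_of_stuck`). The number of iterations is thus an energy difference, `40 + 2 * height n`, with
`63 * (n + 1) + 42` vertices. All weights are integers. Adding a constant to every edge changes all
tours equally and yields the triangle inequality; a strictly monotone additive map carries
everything to the reals. -/

open Finset

/-! ### Tours and the possible differences of two tours under a 2.5-swap -/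

namespace TSPInstance

section Tours

variable {V : Type} [DecidableEq V]

/-- A cyclic enumeration of the vertices gives a tour. -/
theorem isTour_image_equiv {n : ℕ} (e : Fin (n + 3) ≃ V) :
    IsTour (univ.image fun i : Fin (n + 3) => s(e i, e (i + 1))) := by
  classical
  have : Fintype V := Fintype.ofEquiv _ e
  let f : SimpleGraph.cycleGraph (n + 3) →g (⊤ : SimpleGraph V) :=
    ⟨e, fun {a b} h => by
      simpa using h.ne⟩
  have hc : ((SimpleGraph.cycleGraph.cycle n).map f).IsCycle :=
    SimpleGraph.cycleGraph.isCycle_cycle.map e.injective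
  refine ⟨e 0, (SimpleGraph.cycleGraph.cycle n).map f, ?_, ?_⟩
  · rw [SimpleGraph.Walk.isHamiltonianCycle_iff_isCycle_and_length_eq]
    refine ⟨hc, ?_⟩
    rw [SimpleGraph.Walk.length_map, SimpleGraph.cycleGraph.length_cycle,
      ← Fintype.card_congr e, Fintype.card_fin]
  · apply Finset.eq_of_subset_of_card_le
    · intro x hx
      rw [List.mem_toFinset, SimpleGraph.Walk.edges_map, List.mem_map] at hx
      obtain ⟨y, hy, rfl⟩ := hx
      have hadj := SimpleGraph.Walk.edges_subset_edgeSet _ hy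
      induction y using Sym2.ind with
      | _ a b =>
        rw [SimpleGraph.mem_edgeSet, SimpleGraph.cycleGraph_adj] at hadj
        rw [mem_image]
        rcases hadj with h | h
        · refine ⟨b, mem_univ _, ?_⟩
          rw [← h, add_sub_cancel]
          simp [f, Sym2.eq_swap]
        · refine ⟨a, mem_univ _, ?_⟩
          rw [← h, add_sub_cancel]
          simp [f]
    · rw [List.toFinset_card_of_nodup hc.edges_nodup, SimpleGraph.Walk.length_edges,
        SimpleGraph.Walk.length_map, SimpleGraph.cycleGraph.length_cycle]
      exact card_image_le.trans (by simp)

/-- Every vertex lies on exactly two edges of `T`. -/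
def TwoRegular (T : Finset (Sym2 V)) : Prop :=
  ∀ v, ∃ p q, p ≠ q ∧ ∀ r, s(v, r) ∈ T ↔ r = p ∨ r = q

theorem IsTour.twoRegular {T : Finset (Sym2 V)} (hT : IsTour T) : TwoRegular T := by
  obtain ⟨u, p, hp, rfl⟩ := hT
  intro v
  have h := hp.isCycle.ncard_neighborSet_toSubgraph_eq_two (hp.mem_support v)
  rw [Set.ncard_eq_two] at h
  obtain ⟨x, y, hxy, h⟩ := h
  refine ⟨x, y, hxy, fun r => ?_⟩
  have : r ∈ p.toSubgraph.neighborSet v ↔ r ∈ ({x, y} : Set V) := by rw [h]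
  rw [SimpleGraph.Subgraph.mem_neighborSet, SimpleGraph.Walk.adj_toSubgraph_iff_mem_edges] at this
  simpa using this

theorem IsTour.not_isDiag {T : Finset (Sym2 V)} (hT : IsTour T) {e : Sym2 V} (he : e ∈ T) :
    ¬ e.IsDiag := by
  obtain ⟨u, p, hp, rfl⟩ := hT
  have := SimpleGraph.Walk.edges_subset_edgeSet _ (List.mem_toFinset.1 he)
  exact SimpleGraph.not_isDiag_of_mem_edgeSet _ this

theorem IsTour.card_eq [Fintype V] {T : Finset (Sym2 V)} (hT : IsTour T) :
    T.card = Fintype.card V := by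
  obtain ⟨u, p, hp, rfl⟩ := hT
  rw [List.toFinset_card_of_nodup hp.isCycle.edges_nodup, SimpleGraph.Walk.length_edges,
    hp.length_eq]

variable {T T' : Finset (Sym2 V)}

/-- Degrees agree: a vertex that loses an edge must gain one. -/
theorem TwoRegular.exists_new (h : TwoRegular T) (h' : TwoRegular T') {v a : V}
    (ha : s(v, a) ∈ T \ T') : ∃ b, s(v, b) ∈ T' \ T := by
  obtain ⟨p, q, hpq, H⟩ := h v
  obtain ⟨p', q', hpq', H'⟩ := h' v
  simp only [mem_sdiff, H, H'] at ha ⊢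
  by_contra hcon
  push Not at hcon
  have h1 := hcon p' (Or.inl rfl)
  have h2 := hcon q' (Or.inr rfl)
  grind

theorem TwoRegular.exists_two_new (h : TwoRegular T) (h' : TwoRegular T') {v a b : V}
    (hab : a ≠ b) (ha : s(v, a) ∈ T \ T') (hb : s(v, b) ∈ T \ T') :
    ∃ c d, c ≠ d ∧ s(v, c) ∈ T' \ T ∧ s(v, d) ∈ T' \ T := by
  obtain ⟨p, q, hpq, H⟩ := h v
  obtain ⟨p', q', hpq', H'⟩ := h' v
  simp only [mem_sdiff, H, H'] at ha hb ⊢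
  exact ⟨p', q', hpq', by grind, by grind⟩

theorem card_sdiff_eq_of_card_eq (h : T.card = T'.card) : (T \ T').card = (T' \ T).card := by
  have h1 := card_sdiff_add_card_inter T T'
  have h2 := card_sdiff_add_card_inter T' T
  rw [inter_comm] at h2
  omega

/-- The edges exchanged by a 2-swap. -/
def IsTwoExchange (O N : Finset (Sym2 V)) (a b c d : V) : Prop :=
  O = {s(a, b), s(c, d)} ∧ N = {s(a, c), s(b, d)} ∧
    a ≠ b ∧ a ≠ c ∧ a ≠ d ∧ b ≠ c ∧ b ≠ d ∧ c ≠ d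

/-- The edges exchanged by the insertion of `v` between `x` and `y`. -/
def IsInsertion (O N : Finset (Sym2 V)) (u v w x y : V) : Prop :=
  O = {s(u, v), s(v, w), s(x, y)} ∧ N = {s(u, w), s(v, x), s(v, y)} ∧
    u ≠ v ∧ u ≠ w ∧ v ≠ w ∧ x ≠ y ∧ x ≠ u ∧ x ≠ v ∧ x ≠ w ∧ y ≠ u ∧ y ≠ v ∧ y ≠ w

theorem mk_mem_sdiff_comm {u v : V} : s(u, v) ∈ T \ T' ↔ s(v, u) ∈ T \ T' := by
  rw [Sym2.eq_swap]

/-- Only degrees matter here: every endpoint of a removed edge must receive new edges whose ends are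
again endpoints of removed edges, which leaves only the two reconnections of four distinct ends. -/
theorem exchange_of_card_two (h : TwoRegular T) (h' : TwoRegular T')
    (hd : ∀ e ∈ T, ¬ e.IsDiag) (hd' : ∀ e ∈ T', ¬ e.IsDiag) (hcard : T.card = T'.card)
    (hO : (T \ T').card = 2) : ∃ a b c d, IsTwoExchange (T \ T') (T' \ T) a b c d := by
  have hN : (T' \ T).card = 2 := by rw [← card_sdiff_eq_of_card_eq hcard, hO]
  have hdisj : ∀ e, e ∈ T \ T' → e ∈ T' \ T → False := by
    intro e h1 h2
    simp only [mem_sdiff] at h1 h2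
    exact h1.2 h2.1
  obtain ⟨e, f, hef, hO'⟩ := card_eq_two.1 hO
  induction e using Sym2.ind with
  | _ a b =>
  induction f using Sym2.ind with
  | _ c d =>
  have hab : s(a, b) ∈ T \ T' := by rw [hO']; simp
  have hcd : s(c, d) ∈ T \ T' := by rw [hO']; simp
  have hba := mk_mem_sdiff_comm.1 hab
  have hdc := mk_mem_sdiff_comm.1 hcd
  have nab : a ≠ b := by simpa using hd _ (mem_sdiff.1 hab).1
  have ncd : c ≠ d := by simpa using hd _ (mem_sdiff.1 hcd).1
  have hold : ∀ x y, s(x, y) ∈ T' \ T → x ≠ y ∧ (y = a ∨ y = b ∨ y = c ∨ y = d) := by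
    intro x y hxy
    refine ⟨by simpa using hd' _ (mem_sdiff.1 hxy).1, ?_⟩
    obtain ⟨z, hz⟩ := h'.exists_new h (mk_mem_sdiff_comm.1 hxy)
    rw [hO'] at hz
    simp only [mem_insert, mem_singleton, Sym2.eq_iff] at hz
    grind
  -- If the removed edges shared the end `a`, a new edge at `a` could only lead to `b` or `d`, and
  -- would be a removed edge.
  have disjoint_edges : ∀ a b d : V, T \ T' = {s(a, b), s(a, d)} → b ≠ d → False := by
    intro a b d hO' nbd
    have hab : s(a, b) ∈ T \ T' := by rw [hO']; simp
    have had : s(a, d) ∈ T \ T' := by rw [hO']; simp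
    obtain ⟨p, hp⟩ := h.exists_new h' hab
    obtain ⟨z, hz⟩ := h'.exists_new h (mk_mem_sdiff_comm.1 hp)
    have hap : a ≠ p := by simpa using hd' _ (mem_sdiff.1 hp).1
    rw [hO'] at hz
    simp only [mem_insert, mem_singleton, Sym2.eq_iff] at hz
    have : p = b ∨ p = d := by grind
    rcases this with rfl | rfl
    · exact hdisj _ hab hp
    · exact hdisj _ had hp
  have nac : a ≠ c := by
    rintro rfl
    exact disjoint_edges a b d hO' (by rintro rfl; exact hef rfl)
  have nad : a ≠ d := by
    rintro rfl
    refine disjoint_edges a b c (by rw [hO', Sym2.eq_swap (a := c)]) ?_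
    rintro rfl; exact hef Sym2.eq_swap
  have nbc : b ≠ c := by
    rintro rfl
    refine disjoint_edges b a d (by rw [hO', Sym2.eq_swap (a := a)]) nad
  have nbd : b ≠ d := by
    rintro rfl
    refine disjoint_edges b a c (by rw [hO', Sym2.eq_swap (a := a), Sym2.eq_swap (a := c)]) nac
  have uniq : ∀ x p q, p ≠ q → s(x, p) ∈ T' \ T → s(x, q) ∈ T' \ T → False := by
    intro x p q hpq h1 h2
    obtain ⟨r, t, hrt, h3, h4⟩ := h'.exists_two_new h hpq h1 h2
    rw [hO'] at h3 h4
    simp only [mem_insert, mem_singleton, Sym2.eq_iff] at h3 h4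
    grind
  have main : ∀ c d : V, T \ T' = {s(a, b), s(c, d)} → a ≠ c → a ≠ d → b ≠ c → b ≠ d → c ≠ d →
      s(c, d) ∈ T \ T' → s(a, c) ∈ T' \ T →
      ∃ a b c d, IsTwoExchange (T \ T') (T' \ T) a b c d := by
    intro c d hO' nac nad nbc nbd ncd hcd hac
    have hold : ∀ x y, s(x, y) ∈ T' \ T → x ≠ y ∧ (y = a ∨ y = b ∨ y = c ∨ y = d) := by
      intro x y hxy
      refine ⟨by simpa using hd' _ (mem_sdiff.1 hxy).1, ?_⟩
      obtain ⟨z, hz⟩ := h'.exists_new h (mk_mem_sdiff_comm.1 hxy)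
      rw [hO'] at hz
      simp only [mem_insert, mem_singleton, Sym2.eq_iff] at hz
      grind
    obtain ⟨z, hz⟩ := h.exists_new h' hba
    have hzd : z = d := by
      obtain ⟨h1, rfl | rfl | rfl | rfl⟩ := hold _ _ hz
      · exact (hdisj _ hba hz).elim
      · exact (h1 rfl).elim
      · exact (uniq z a b nab (mk_mem_sdiff_comm.1 hac) (mk_mem_sdiff_comm.1 hz)).elim
      · rfl
    subst hzd
    refine ⟨a, b, c, z, hO', ?_, nab, nac, nad, nbc, nbd, ncd⟩
    symm
    apply Finset.eq_of_subset_of_card_le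
    · intro e he
      simp only [mem_insert, mem_singleton] at he
      rcases he with rfl | rfl <;> assumption
    · rw [hN, card_pair]
      simp only [ne_eq, Sym2.eq_iff]
      grind
  obtain ⟨p, hp⟩ := h.exists_new h' hab
  obtain ⟨h1, rfl | rfl | rfl | rfl⟩ := hold _ _ hp
  · exact (h1 rfl).elim
  · exact (hdisj _ hab hp).elim
  · exact main p d hO' nac nad nbc nbd ncd hcd hp
  · exact main p c (by rw [hO', Sym2.eq_swap (a := c)]) nad nac nbd nbc ncd.symm hdc hp

/-- The common end `v` of two removed edges gains two edges, which can only go to the ends of the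
third removed edge. The former neighbors of `v` are then left to be joined to each other. -/
theorem insertion_of_card_three (h : TwoRegular T) (h' : TwoRegular T')
    (hd : ∀ e ∈ T, ¬ e.IsDiag) (hd' : ∀ e ∈ T', ¬ e.IsDiag) (hcard : T.card = T'.card)
    (hO : (T \ T').card = 3)
    (hinc : ∃ e ∈ T \ T', ∃ f ∈ T \ T', e ≠ f ∧ ∃ v, v ∈ e ∧ v ∈ f) :
    ∃ u v w x y, IsInsertion (T \ T') (T' \ T) u v w x y := by
  have hN : (T' \ T).card = 3 := by rw [← card_sdiff_eq_of_card_eq hcard, hO]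
  have hdisj : ∀ e, e ∈ T \ T' → e ∈ T' \ T → False := by
    intro e h1 h2
    simp only [mem_sdiff] at h1 h2
    exact h1.2 h2.1
  obtain ⟨e, he, f, hf, hef, v, hve, hvf⟩ := hinc
  obtain ⟨u, rfl⟩ := hve
  obtain ⟨w, rfl⟩ := hvf
  have huw : u ≠ w := by rintro rfl; exact hef rfl
  have huv : u ≠ v := by
    have := hd _ (mem_sdiff.1 he).1
    simp only [Sym2.mk_isDiag_iff] at this
    exact fun h => this h.symm
  have hvw : v ≠ w := by simpa using hd _ (mem_sdiff.1 hf).1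
  obtain ⟨g, hg⟩ : ∃ g, T \ T' = {s(v, u), s(v, w), g} := by
    have h1 : ({s(v, u), s(v, w)} : Finset (Sym2 V)) ⊆ T \ T' := by
      intro e' he'
      simp only [mem_insert, mem_singleton] at he'
      rcases he' with rfl | rfl <;> assumption
    have h2 : ((T \ T') \ {s(v, u), s(v, w)}).card = 1 := by
      rw [card_sdiff_of_subset h1, hO, card_pair hef]
    obtain ⟨g, hg⟩ := card_eq_one.1 h2
    refine ⟨g, ?_⟩
    rw [← sdiff_union_of_subset h1, hg]
    ext e'
    simp only [mem_union, mem_singleton, mem_insert]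
    tauto
  induction g using Sym2.ind with
  | _ x y =>
  have hxyO : s(x, y) ∈ T \ T' := by rw [hg]; simp
  have nxy : x ≠ y := by simpa using hd _ (mem_sdiff.1 hxyO).1
  have two : ∀ z p q, p ≠ q → s(z, p) ∈ T' \ T → s(z, q) ∈ T' \ T →
      ∃ r t, r ≠ t ∧ s(z, r) ∈ T \ T' ∧ s(z, t) ∈ T \ T' := by
    intro z p q hpq h1 h2
    exact h'.exists_two_new h hpq h1 h2
  have hnew : ∀ z p, s(z, p) ∈ T' \ T → z ≠ p ∧ (p = u ∨ p = v ∨ p = w ∨ p = x ∨ p = y) := by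
    intro z p hzp
    refine ⟨by simpa using hd' _ (mem_sdiff.1 hzp).1, ?_⟩
    obtain ⟨t, ht⟩ := h'.exists_new h (mk_mem_sdiff_comm.1 hzp)
    rw [hg] at ht
    simp only [mem_insert, mem_singleton, Sym2.eq_iff] at ht
    grind
  obtain ⟨p, q, hpq, hp, hq⟩ := h.exists_two_new h' huw he hf
  have hnu : ∀ p, s(v, p) ∈ T' \ T → p ≠ u ∧ p ≠ v ∧ p ≠ w ∧ (p = x ∨ p = y) := by
    intro p hp
    have h1 : p ≠ u := by rintro rfl; exact hdisj _ he hp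
    have h2 : p ≠ w := by rintro rfl; exact hdisj _ hf hp
    have h3 := hnew _ _ hp
    refine ⟨h1, h3.1.symm, h2, ?_⟩
    have := h3.1
    grind
  obtain ⟨hpu, hpv, hpw, hp'⟩ := hnu p hp
  obtain ⟨hqu, hqv, hqw, hq'⟩ := hnu q hq
  have main : ∀ x y, T \ T' = {s(v, u), s(v, w), s(x, y)} → x ≠ y →
      s(v, x) ∈ T' \ T → s(v, y) ∈ T' \ T → x ≠ u → x ≠ v → x ≠ w → y ≠ u → y ≠ v → y ≠ w →
      ∃ u v w x y, IsInsertion (T \ T') (T' \ T) u v w x y := by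
    intro x y hg nxy hx hy hxu hxv hxw hyu hyv hyw
    have only : ∀ z r t, z = x ∨ z = y → r ≠ t → s(z, r) ∈ T \ T' → s(z, t) ∈ T \ T' → False := by
      intro z r t hz hrt h1 h2
      rw [hg] at h1 h2
      simp only [mem_insert, mem_singleton, Sym2.eq_iff] at h1 h2
      grind
    obtain ⟨z, hz⟩ := h.exists_new h' (mk_mem_sdiff_comm.1 he)
    -- The ends `x` and `y` lose one edge each and have already received theirs from `v`.
    have hzw : z = w := by
      obtain ⟨t, ht⟩ := h'.exists_new h (mk_mem_sdiff_comm.1 hz)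
      have huz : u ≠ z := by simpa using hd' _ (mem_sdiff.1 hz).1
      have hzv : z ≠ v := by rintro rfl; exact hdisj _ (mk_mem_sdiff_comm.1 he) hz
      have hzx : z ≠ x := by
        rintro rfl
        obtain ⟨r, t, hrt, h1, h2⟩ := two z u v huv (mk_mem_sdiff_comm.1 hz)
          (mk_mem_sdiff_comm.1 hx)
        exact only z r t (Or.inl rfl) hrt h1 h2
      have hzy : z ≠ y := by
        rintro rfl
        obtain ⟨r, t, hrt, h1, h2⟩ := two z u v huv (mk_mem_sdiff_comm.1 hz)
          (mk_mem_sdiff_comm.1 hy)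
        exact only z r t (Or.inr rfl) hrt h1 h2
      rw [hg] at ht
      simp only [mem_insert, mem_singleton, Sym2.eq_iff] at ht
      grind
    subst hzw
    refine ⟨u, v, z, x, y, ?_, ?_, huv, huw, hvw, nxy, hxu, hxv, hxw, hyu, hyv, hyw⟩
    · rw [hg, Sym2.eq_swap (a := u)]
    · symm
      apply Finset.eq_of_subset_of_card_le
      · intro e he
        simp only [mem_insert, mem_singleton] at he
        rcases he with rfl | rfl | rfl <;> assumption
      · rw [hN]
        refine (card_eq_three.2 ⟨_, _, _, ?_, ?_, ?_, rfl⟩).ge <;>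
        · simp only [ne_eq, Sym2.eq_iff]
          grind
  rcases hp' with rfl | rfl <;> rcases hq' with rfl | rfl
  · exact (hpq rfl).elim
  · exact main p q hg nxy hp hq hpu hpv hpw hqu hqv hqw
  · exact main q p hg nxy hq hp hqu hqv hqw hpu hpv hpw
  · exact (hpq rfl).elim

/-- The difference of two tours connected by a 2.5-swap is a 2-exchange or an insertion. -/
theorem exchange_or_insertion_of_swap [Fintype V] (hT : IsTour T) (hT' : IsTour T')
    {E₁ E₂ : Finset (Sym2 V)} (hE : IsTwoHalfSwap E₁ E₂)
    (h : T' = (T \ E₁) ∪ E₂) (hne : T ≠ T') :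
    (∃ a b c d, IsTwoExchange (T \ T') (T' \ T) a b c d) ∨
      ∃ u v w x y, IsInsertion (T \ T') (T' \ T) u v w x y := by
  have hcard : T.card = T'.card := by rw [hT.card_eq, hT'.card_eq]
  have hsub : T \ T' ⊆ E₁ := by
    intro e he
    rw [mem_sdiff, h, mem_union, mem_sdiff] at he
    by_contra hcon
    exact he.2 (Or.inl ⟨he.1, hcon⟩)
  have hle := card_le_card hsub
  have h0 : (T \ T').card ≠ 0 := by
    intro h0
    rw [card_eq_zero, sdiff_eq_empty_iff_subset] at h0
    exact hne (Finset.eq_of_subset_of_card_le h0 hcard.ge)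
  -- Both ends of a single removed edge would need a new edge, and the only new edge would join the
  -- same two ends.
  have h1 : (T \ T').card ≠ 1 := by
    intro h1
    have h1' : (T' \ T).card = 1 := by rw [← card_sdiff_eq_of_card_eq hcard, h1]
    obtain ⟨e, he⟩ := card_eq_one.1 h1
    obtain ⟨f, hf⟩ := card_eq_one.1 h1'
    induction e using Sym2.ind with
    | _ a b =>
    have hab : s(a, b) ∈ T \ T' := by rw [he]; simp
    obtain ⟨p, hp⟩ := hT.twoRegular.exists_new hT'.twoRegular hab
    obtain ⟨q, hq⟩ := hT.twoRegular.exists_new hT'.twoRegular (mk_mem_sdiff_comm.1 hab)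
    have nab : a ≠ b := by simpa using hT.not_isDiag (mem_sdiff.1 hab).1
    have hpq : s(a, p) = s(b, q) := by
      rw [hf, mem_singleton] at hp hq
      rw [hp, hq]
    have : p = b := by
      rw [Sym2.eq_iff] at hpq
      grind
    subst this
    exact (mem_sdiff.1 hab).2 (mem_sdiff.1 hp).1
  have hd := fun e he => hT.not_isDiag (e := e) he
  have hd' := fun e he => hT'.not_isDiag (e := e) he
  rcases hE.2 with h2 | ⟨h3, hinc⟩
  · exact Or.inl (exchange_of_card_two hT.twoRegular hT'.twoRegular hd hd' hcard (by omega))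
  -- One of the three removed edges may be put back by `E₂`, which leaves a 2-exchange.
  · by_cases h2 : (T \ T').card = 2
    · exact Or.inl (exchange_of_card_two hT.twoRegular hT'.twoRegular hd hd' hcard h2)
    · have h4 : T \ T' = E₁ := Finset.eq_of_subset_of_card_le hsub (by omega)
      exact Or.inr (insertion_of_card_three hT.twoRegular hT'.twoRegular hd hd' hcard (by omega)
        (by rw [h4]; exact hinc))

end Tours

end TSPInstance

/-! ### Slot systems and the tour of a configuration -/

/-- Tokens with two possible places each. A place is a position between `1` and `6` in a slot.
The slots are arranged in a cycle, and the graph that has the slots as vertices and the tokens as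
edges has no cycle with at most four edges. -/
structure SlotSystem (Tok S : Type) where
  /-- the two slots of a token -/
  place : Tok → Bool → S
  /-- the two positions of a token in its slots -/
  pos : Tok → Bool → ℕ
  one_le_pos : ∀ x b, 1 ≤ pos x b
  pos_le : ∀ x b, pos x b ≤ 6
  inj : ∀ x b y c, place x b = place y c → pos x b = pos y c → x = y ∧ b = c
  place_ne : ∀ x b c, place x b = place x c → b = c
  no_two_cycle : ∀ x b y c, x ≠ y → place x (!b) = place y c → place y (!c) = place x b → False
  no_three_cycle : ∀ x b y c z d, place x (!b) = place y c → place y (!c) = place z d →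
    place z (!d) = place x b → False
  no_four_cycle : ∀ x b y c z d t e, [x, y, z, t].Nodup → place x (!b) = place y c →
    place y (!c) = place z d → place z (!d) = place t e → place t (!e) = place x b → False
  /-- the number of slots, minus two -/
  num : ℕ
  /-- the cyclic arrangement of the slots -/
  enum : S ≃ Fin (num + 2)

namespace SlotSystem

variable {Tok S : Type} (P : SlotSystem Tok S)

/-- The vertices: the tokens, and two backbone vertices for each slot. -/
abbrev Vert (Tok S : Type) : Type := Tok ⊕ S × Bool

/-- The position of a backbone vertex in its slot. -/
def endPos (b : Bool) : ℕ := bif b then 7 else 0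

/-- The vertex `v` may sit at position `a` of slot `s`. -/
def Sits : Vert Tok S → S → ℕ → Prop
  | .inl x, s, a => ∃ b, P.place x b = s ∧ P.pos x b = a
  | .inr t, s, a => t.1 = s ∧ endPos t.2 = a

/-- With the configuration `σ`, the vertex `v` sits at position `a` of slot `s`. -/
def Occ (σ : Tok → Bool) : Vert Tok S → S → ℕ → Prop
  | .inl x, s, a => P.place x (σ x) = s ∧ P.pos x (σ x) = a
  | .inr t, s, a => t.1 = s ∧ endPos t.2 = a

/-- The slot after `s`. -/
def next (s : S) : S := P.enum.symm (P.enum s + 1)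

/-- The edges between consecutive slots. -/
def IsGap (e : Sym2 (Vert Tok S)) : Prop :=
  ∃ s, e = s(.inr (s, true), .inr (P.next s, false))

/-- With the configuration `σ`, the vertices `v` and `w` sit next to each other in slot `s`, at
positions `a < b`. -/
def Cons (σ : Tok → Bool) (s : S) (a b : ℕ) (v w : Vert Tok S) : Prop :=
  P.Occ σ v s a ∧ P.Occ σ w s b ∧ a < b ∧ ∀ z c, P.Occ σ z s c → a < c → c < b → False

/-- The edge set of the tour of the configuration `σ`. -/
noncomputable def tour [Fintype Tok] [Fintype S] (σ : Tok → Bool) : Finset (Sym2 (Vert Tok S)) := by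
  classical
  exact univ.filter fun e => P.IsGap e ∨ ∃ s a b v w, e = s(v, w) ∧ P.Cons σ s a b v w

theorem mem_tour [Fintype Tok] [Fintype S] {σ : Tok → Bool} {e : Sym2 (Vert Tok S)} :
    e ∈ P.tour σ ↔ P.IsGap e ∨ ∃ s a b v w, e = s(v, w) ∧ P.Cons σ s a b v w := by
  classical
  simp [tour]

variable {P} {σ : Tok → Bool} {v w : Vert Tok S} {s t : S} {a b c : ℕ}

theorem Occ.sits (h : P.Occ σ v s a) : P.Sits v s a := by
  rcases v with x | t
  · exact ⟨σ x, h⟩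
  · exact h

theorem Sits.le (h : P.Sits v s a) : a ≤ 7 := by
  rcases v with x | ⟨t, b⟩
  · obtain ⟨b, rfl, rfl⟩ := h
    exact (P.pos_le x b).trans (by norm_num)
  · obtain ⟨rfl, rfl⟩ := h
    cases b <;> simp [endPos]

theorem Sits.pos_unique (h : P.Sits v s a) (h' : P.Sits v s b) : a = b := by
  rcases v with x | t
  · obtain ⟨c, rfl, rfl⟩ := h
    obtain ⟨d, h1, rfl⟩ := h'
    rw [P.place_ne _ _ _ h1]
  · exact h.2.symm.trans h'.2

theorem Sits.vert_unique (h : P.Sits v s a) (h' : P.Sits w s a) : v = w := by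
  rcases v with x | ⟨t, c⟩ <;> rcases w with y | ⟨t', d⟩
  · obtain ⟨c, rfl, rfl⟩ := h
    obtain ⟨d, h1, h2⟩ := h'
    rw [(P.inj _ _ _ _ h1.symm h2.symm).1]
  · obtain ⟨c, rfl, rfl⟩ := h
    obtain ⟨h1, h2⟩ := h'
    have := P.one_le_pos x c
    have := P.pos_le x c
    cases d <;> simp [endPos] at h2 <;> omega
  · obtain ⟨d, rfl, rfl⟩ := h'
    obtain ⟨h1, h2⟩ := h
    have := P.one_le_pos y d
    have := P.pos_le y d
    cases c <;> simp [endPos] at h2 <;> omega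
  · obtain ⟨h1, h2⟩ := h
    obtain ⟨h3, h4⟩ := h'
    cases c <;> cases d <;> simp_all [endPos] <;> omega

theorem Sits.pos_ne (h : P.Sits v s a) (h' : P.Sits w s b) (hvw : v ≠ w) : a ≠ b := by
  rintro rfl
  exact hvw (h.vert_unique h')

theorem Occ.unique (h : P.Occ σ v s a) (h' : P.Occ σ v t b) : s = t ∧ a = b := by
  rcases v with x | ⟨u, d⟩
  · exact ⟨h.1.symm.trans h'.1, h.2.symm.trans h'.2⟩
  · exact ⟨h.1.symm.trans h'.1, h.2.symm.trans h'.2⟩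

variable (P σ) in
theorem exists_occ (v : Vert Tok S) : ∃ s a, P.Occ σ v s a := by
  rcases v with x | t
  · exact ⟨_, _, rfl, rfl⟩
  · exact ⟨_, _, rfl, rfl⟩

variable (P σ s) in
theorem occ_left : P.Occ σ (.inr (s, false)) s 0 := ⟨rfl, rfl⟩

variable (P σ s) in
theorem occ_right : P.Occ σ (.inr (s, true)) s 7 := ⟨rfl, rfl⟩

/-- The last occupied position before `c`. -/
theorem exists_last_before (hc : 0 < c) : ∃ a v, P.Occ σ v s a ∧ a < c ∧
    ∀ z d, P.Occ σ z s d → a < d → d < c → False := by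
  classical
  have h0 : ∃ v, P.Occ σ v s 0 := ⟨_, P.occ_left σ s⟩
  have h1 := Nat.findGreatest_spec (P := fun a => ∃ v, P.Occ σ v s a) (Nat.zero_le (c - 1)) h0
  obtain ⟨v, hv⟩ := h1
  refine ⟨_, v, hv, ?_, ?_⟩
  · have := Nat.findGreatest_le (P := fun a => ∃ v, P.Occ σ v s a) (c - 1)
    omega
  · intro z d hz h2 h3
    exact Nat.findGreatest_is_greatest h2 (by omega) ⟨z, hz⟩

/-- The first occupied position after `c`. -/
theorem exists_first_after (hc : c < 7) : ∃ b w, P.Occ σ w s b ∧ c < b ∧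
    ∀ z d, P.Occ σ z s d → c < d → d < b → False := by
  classical
  have h0 : ∃ b, c < b ∧ ∃ v, P.Occ σ v s b := ⟨7, hc, _, P.occ_right σ s⟩
  obtain ⟨h1, v, hv⟩ := Nat.find_spec h0
  refine ⟨_, v, hv, h1, ?_⟩
  intro z d hz h2 h3
  exact Nat.find_min h0 h3 ⟨h2, z, hz⟩

theorem Cons.ne (h : P.Cons σ s a b v w) : v ≠ w := by
  rintro rfl
  exact absurd (h.1.unique h.2.1).2 h.2.2.1.ne

theorem next_ne (s : S) : P.next s ≠ s := by
  intro h
  have h1 := congrArg P.enum h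
  rw [next, Equiv.apply_symm_apply] at h1
  simp at h1

/-- The place of a vertex in the linear order of the tour. -/
def coord (P : SlotSystem Tok S) (σ : Tok → Bool) : Vert Tok S → ℕ
  | .inl x => 8 * (P.enum (P.place x (σ x))).val + P.pos x (σ x)
  | .inr t => 8 * (P.enum t.1).val + endPos t.2

theorem Occ.coord_eq (h : P.Occ σ v s a) : P.coord σ v = 8 * (P.enum s).val + a := by
  rcases v with x | t
  · obtain ⟨rfl, rfl⟩ := h
    rfl
  · obtain ⟨rfl, rfl⟩ := h
    rfl

/-- Positions are at most 7, so the factor 8 keeps the slots apart. -/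
theorem coord_injective : Function.Injective (P.coord σ) := by
  intro v w h
  obtain ⟨s, a, hv⟩ := P.exists_occ σ v
  obtain ⟨t, b, hw⟩ := P.exists_occ σ w
  rw [hv.coord_eq, hw.coord_eq] at h
  have h1 := hv.sits.le
  have h2 := hw.sits.le
  have h3 : P.enum s = P.enum t := by
    apply Fin.ext
    omega
  have h4 := P.enum.injective h3
  subst h4
  have h5 : a = b := by omega
  subst h5
  exact hv.sits.vert_unique hw.sits

theorem three_le_card [Fintype Tok] [Fintype S] (P : SlotSystem Tok S) : 3 ≤ Fintype.card (Vert Tok S) := by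
  have h : Fintype.card S = P.num + 2 := by rw [Fintype.card_congr P.enum, Fintype.card_fin]
  rw [Fintype.card_sum, Fintype.card_prod, Fintype.card_bool]
  omega

section IsTour

variable [Fintype Tok] [Fintype S] [DecidableEq Tok] [DecidableEq S]

-- In the order given by `coord`, the edges of a configuration are exactly the successor pairs,
-- closed up by one gap edge from the last vertex to the first.
variable (P σ) in
theorem isTour_tour : TSPInstance.IsTour (P.tour σ) := by
  classical
  obtain ⟨n, hn⟩ := Nat.exists_eq_add_of_le (three_le_card P)
  let _ : LinearOrder (Vert Tok S) := LinearOrder.lift' (P.coord σ) coord_injective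
  have hlt : ∀ v w : Vert Tok S, v < w ↔ P.coord σ v < P.coord σ w := fun v w => Iff.rfl
  let e : Fin (n + 3) ≃o Vert Tok S := Fintype.orderIsoFinOfCardEq _ (by rw [hn, add_comm])
  have hsucc : ∀ v w : Vert Tok S, v < w → (∀ z, v < z → z < w → False) →
      e.symm w = e.symm v + 1 := by
    intro v w hvw hz
    have h1 : e.symm v < e.symm w := e.symm.lt_iff_lt.2 hvw
    have h2 : (e.symm v).val + 1 < n + 3 := by
      have := (e.symm w).isLt
      have : (e.symm v).val < (e.symm w).val := h1
      omega
    have h3 : (e.symm v + 1).val = (e.symm v).val + 1 := Fin.val_add_one_of_lt' h2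
    by_contra hne
    apply hz (e (e.symm v + 1))
    · rw [← e.symm.lt_iff_lt, e.symm_apply_apply, Fin.lt_def, h3]
      omega
    · rw [← e.symm.lt_iff_lt, e.symm_apply_apply, Fin.lt_def, h3]
      have h4 : (e.symm v).val < (e.symm w).val := h1
      have h5 : (e.symm w).val ≠ (e.symm v).val + 1 := by
        rw [← h3]
        exact fun h => hne (Fin.ext h)
      omega
  have hcons : ∀ s a b v w, P.Cons σ s a b v w → e.symm w = e.symm v + 1 := by
    rintro s a b v w ⟨hv, hw, hab, hno⟩
    apply hsucc
    · rw [hlt, hv.coord_eq, hw.coord_eq]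
      omega
    · intro z h1 h2
      obtain ⟨t, c, hz⟩ := P.exists_occ σ z
      rw [hlt, hv.coord_eq, hz.coord_eq] at h1
      rw [hlt, hw.coord_eq, hz.coord_eq] at h2
      have h3 := hw.sits.le
      have h4 := hz.sits.le
      have h5 : P.enum t = P.enum s := by
        apply Fin.ext
        omega
      have h6 := P.enum.injective h5
      subst h6
      exact hno z c hz (by omega) (by omega)
  have hgap : ∀ s, e.symm (.inr (P.next s, false)) = e.symm (.inr (s, true)) + 1 := by
    intro s
    have hr := P.occ_right σ s
    have hl := P.occ_left σ (P.next s)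
    have hen : P.enum (P.next s) = P.enum s + 1 := by
      rw [next, Equiv.apply_symm_apply]
    by_cases hlast : (P.enum s).val + 1 < P.num + 2
    · have hv : (P.enum s + 1).val = (P.enum s).val + 1 := Fin.val_add_one_of_lt' hlast
      apply hsucc
      · rw [hlt, hr.coord_eq, hl.coord_eq, hen, hv]
        omega
      · intro z h1 h2
        rw [hlt, hr.coord_eq] at h1
        rw [hlt, hl.coord_eq, hen, hv] at h2
        omega
    -- The gap after the last slot wraps around.
    · have hs : P.enum s = Fin.last (P.num + 1) := by
        apply Fin.ext
        have := (P.enum s).isLt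
        simp only [Fin.val_last]
        omega
      have h0 : P.enum (P.next s) = 0 := by rw [hen, hs, Fin.last_add_one]
      have h1 : e.symm (.inr (s, true)) = Fin.last (n + 2) := by
        rw [← Fin.top_eq_last, eq_top_iff, ← e.symm_apply_apply ⊤, e.symm.le_iff_le, ← not_lt, hlt]
        obtain ⟨t, c, hz⟩ := P.exists_occ σ (e ⊤)
        rw [hr.coord_eq, hz.coord_eq, hs]
        have := hz.sits.le
        have := (P.enum t).isLt
        simp only [Fin.val_last]
        omega
      have h2 : e.symm (.inr (P.next s, false)) = 0 := by
        rw [← bot_eq_zero, eq_bot_iff, ← e.symm_apply_apply ⊥, e.symm.le_iff_le, ← not_lt, hlt,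
          hl.coord_eq, h0]
        simp
      rw [h1, h2, Fin.last_add_one]
  have himage : P.tour σ = univ.image fun i : Fin (n + 3) => s(e i, e (i + 1)) := by
    ext x
    rw [mem_tour, mem_image]
    constructor
    · rintro (⟨s, rfl⟩ | ⟨s, a, b, v, w, rfl, h⟩)
      · refine ⟨e.symm (.inr (s, true)), mem_univ _, ?_⟩
        rw [← hgap s, e.apply_symm_apply, e.apply_symm_apply]
      · refine ⟨e.symm v, mem_univ _, ?_⟩
        rw [← hcons _ _ _ _ _ h, e.apply_symm_apply, e.apply_symm_apply]
    · rintro ⟨i, -, rfl⟩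
      obtain ⟨s, a, hv⟩ := P.exists_occ σ (e i)
      by_cases ha : a < 7
      · right
        obtain ⟨b, w, hw, hab, hno⟩ := exists_first_after (P := P) (σ := σ) (s := s) ha
        have hc : P.Cons σ s a b (e i) w := ⟨hv, hw, hab, hno⟩
        have := hcons _ _ _ _ _ hc
        rw [e.symm_apply_apply] at this
        refine ⟨s, a, b, e i, w, ?_, hc⟩
        rw [← this, e.apply_symm_apply]
      · left
        have ha' : a = 7 := by
          have := hv.sits.le
          omega
        subst ha'
        have hv' := hv.sits.vert_unique (P.occ_right σ s).sits
        refine ⟨s, ?_⟩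
        have := hgap s
        rw [← hv', e.symm_apply_apply] at this
        rw [← this, e.apply_symm_apply, hv']
  rw [himage]
  exact TSPInstance.isTour_image_equiv e.toEquiv

end IsTour

end SlotSystem

/-! ### Short closed walks through the slots, and the edge weights -/

namespace SlotSystem

variable {Tok S : Type} {P : SlotSystem Tok S} {σ : Tok → Bool} {v w : Vert Tok S} {s t : S}
  {a b c : ℕ}

variable (P) in
/-- The vertex `v` may sit in slot `s`. -/
def Near (v : Vert Tok S) (s : S) : Prop := ∃ a, P.Sits v s a

theorem Sits.near (h : P.Sits v s a) : P.Near v s := ⟨a, h⟩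

theorem Near.eq_or (h : P.Near v s) (h' : P.Near v t) :
    s = t ∨ ∃ x b, v = .inl x ∧ P.place x b = s ∧ P.place x (!b) = t := by
  obtain ⟨a, h⟩ := h
  obtain ⟨a', h'⟩ := h'
  rcases v with x | u
  · obtain ⟨b, rfl, -⟩ := h
    obtain ⟨c, rfl, -⟩ := h'
    by_cases hbc : c = b
    · subst hbc
      exact Or.inl rfl
    · right
      have : c = !b := by cases b <;> cases c <;> simp_all
      subst this
      exact ⟨x, b, rfl, rfl, rfl⟩
  · exact Or.inl (h.1.symm.trans h'.1)

/-- Only a token can belong to two slots, and two different tokens never join the same pair of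
slots. -/
theorem Near.two (hvw : v ≠ w) (h₁ : P.Near v s) (h₂ : P.Near v t) (h₃ : P.Near w t)
    (h₄ : P.Near w s) : s = t := by
  rcases h₁.eq_or h₂ with h | ⟨x, b, rfl, h1, h2⟩
  · exact h
  rcases h₃.eq_or h₄ with h | ⟨y, c, rfl, h3, h4⟩
  · exact h.symm
  exact (P.no_two_cycle x b y c (by rintro rfl; exact hvw rfl) (h2.trans h3.symm)
    (h4.trans h1.symm)).elim

theorem Near.three {v₁ v₂ v₃ : Vert Tok S} {s₁ s₂ s₃ : S} (h₁₂ : v₁ ≠ v₂) (h₁₃ : v₁ ≠ v₃)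
    (h₂₃ : v₂ ≠ v₃) (h₁ : P.Near v₁ s₁) (h₁' : P.Near v₁ s₂) (h₂ : P.Near v₂ s₂)
    (h₂' : P.Near v₂ s₃) (h₃ : P.Near v₃ s₃) (h₃' : P.Near v₃ s₁) : s₁ = s₂ ∧ s₂ = s₃ := by
  rcases h₁.eq_or h₁' with rfl | ⟨x, b, rfl, h1, h2⟩
  · exact ⟨rfl, Near.two h₂₃ h₂ h₂' h₃ h₃'⟩
  rcases h₂.eq_or h₂' with rfl | ⟨y, c, rfl, h3, h4⟩
  · exact ⟨Near.two h₁₃ h₁ h₁' h₃ h₃', rfl⟩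
  rcases h₃.eq_or h₃' with rfl | ⟨z, d, rfl, h5, h6⟩
  · have := Near.two h₁₂ h₁ h₁' h₂ h₂'
    exact ⟨this, this.symm⟩
  exact (P.no_three_cycle x b y c z d (h2.trans h3.symm) (h4.trans h5.symm)
    (h6.trans h1.symm)).elim

/-- If one vertex stays in its slot, the closed walk shortens to length three; otherwise four
distinct tokens would form a forbidden cycle. -/
theorem Near.four {v₁ v₂ v₃ v₄ : Vert Tok S} {s₁ s₂ s₃ s₄ : S} (h₁₂ : v₁ ≠ v₂) (h₁₃ : v₁ ≠ v₃)
    (h₁₄ : v₁ ≠ v₄) (h₂₃ : v₂ ≠ v₃) (h₂₄ : v₂ ≠ v₄) (h₃₄ : v₃ ≠ v₄) (h₁ : P.Near v₁ s₁)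
    (h₁' : P.Near v₁ s₂) (h₂ : P.Near v₂ s₂) (h₂' : P.Near v₂ s₃) (h₃ : P.Near v₃ s₃)
    (h₃' : P.Near v₃ s₄) (h₄ : P.Near v₄ s₄) (h₄' : P.Near v₄ s₁) :
    s₁ = s₂ ∧ s₂ = s₃ ∧ s₃ = s₄ := by
  rcases h₁.eq_or h₁' with rfl | ⟨x, b, rfl, h1, h2⟩
  · exact ⟨rfl, Near.three h₂₃ h₂₄ h₃₄ h₂ h₂' h₃ h₃' h₄ h₄'⟩
  rcases h₂.eq_or h₂' with rfl | ⟨y, c, rfl, h3, h4⟩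
  · obtain ⟨h, h'⟩ := Near.three h₁₃ h₁₄ h₃₄ h₁ h₁' h₃ h₃' h₄ h₄'
    exact ⟨h, rfl, h'⟩
  rcases h₃.eq_or h₃' with rfl | ⟨z, d, rfl, h5, h6⟩
  · obtain ⟨h, h'⟩ := Near.three h₁₂ h₁₄ h₂₄ h₁ h₁' h₂ h₂' h₄ h₄'
    exact ⟨h, h', rfl⟩
  rcases h₄.eq_or h₄' with rfl | ⟨u, e, rfl, h7, h8⟩
  · obtain ⟨h, h'⟩ := Near.three h₁₂ h₁₃ h₂₃ h₁ h₁' h₂ h₂' h₃ h₃'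
    exact ⟨h, h', (h.trans h').symm⟩
  refine (P.no_four_cycle x b y c z d u e ?_ (h2.trans h3.symm) (h4.trans h5.symm)
    (h6.trans h7.symm) (h8.trans h1.symm)).elim
  have inj : ∀ {x y : Tok}, (Sum.inl x : Vert Tok S) ≠ .inl y → x ≠ y := fun h h' => h (h' ▸ rfl)
  simp [inj h₁₂, inj h₁₃, inj h₁₄, inj h₂₃, inj h₂₄, inj h₃₄]

variable (P) in
/-- The edge `e` joins the vertices of a slot that may sit at two given positions. -/
def Inner (q : S × ℕ × ℕ) (e : Sym2 (Vert Tok S)) : Prop :=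
  ∃ v w, e = s(v, w) ∧ P.Sits v q.1 q.2.1 ∧ P.Sits w q.1 q.2.2 ∧ q.2.1 < q.2.2

/-- This makes the choice in the definition of `cost` immaterial. -/
theorem Inner.unique {q q' : S × ℕ × ℕ} {e : Sym2 (Vert Tok S)} (h : P.Inner q e)
    (h' : P.Inner q' e) : q = q' := by
  obtain ⟨s, a, b⟩ := q
  obtain ⟨t, c, d⟩ := q'
  obtain ⟨v, w, rfl, hv, hw, hab⟩ := h
  obtain ⟨v', w', he, hv', hw', hcd⟩ := h'
  simp only at hv hw hab hv' hw' hcd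
  have hne : v ≠ w := by
    rintro rfl
    exact hab.ne (hv.pos_unique hw)
  rcases Sym2.eq_iff.1 he with ⟨rfl, rfl⟩ | ⟨rfl, rfl⟩
  · have := Near.two hne hv.near hv'.near hw'.near hw.near
    subst this
    rw [hv.pos_unique hv', hw.pos_unique hw']
  · have := Near.two hne hv.near hw'.near hv'.near hw.near
    subst this
    have := hv.pos_unique hw'
    have := hw.pos_unique hv'
    omega

theorem not_isGap_of_near (hv : P.Near v s) (hw : P.Near w s) : ¬ P.IsGap s(v, w) := by
  rintro ⟨t, h⟩
  obtain ⟨a, hv⟩ := hv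
  obtain ⟨b, hw⟩ := hw
  rcases Sym2.eq_iff.1 h with ⟨rfl, rfl⟩ | ⟨rfl, rfl⟩
  · exact next_ne t (hw.1.trans hv.1.symm)
  · exact next_ne t (hv.1.trans hw.1.symm)

variable (P) in
/-- The edge weights. -/
noncomputable def cost (A : ℤ) (f : S → ℕ → ℕ → ℤ) (e : Sym2 (Vert Tok S)) : ℤ := by
  classical
  -- With perturbations small against `A`, an edge in a slot costs little more than `7 * A`. So `-16
  -- * A` offsets two of them, and no gap edge is worth removing; `24 * A` exceeds three of them,
  -- and no edge outside the slots is worth adding.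
  exact if h : ∃ q, P.Inner q e then
      A * ((h.choose.2.2 : ℤ) - h.choose.2.1) + f h.choose.1 h.choose.2.1 h.choose.2.2
    else if P.IsGap e then -16 * A else 24 * A

variable {A W : ℤ} {f : S → ℕ → ℕ → ℤ}

theorem cost_of_sits (hv : P.Sits v s a) (hw : P.Sits w s b) (hab : a < b) :
    P.cost A f s(v, w) = A * ((b : ℤ) - a) + f s a b := by
  have h : P.Inner (s, a, b) s(v, w) := ⟨v, w, rfl, hv, hw, hab⟩
  have h' : ∃ q, P.Inner q s(v, w) := ⟨_, h⟩
  rw [cost, dif_pos h', ← h.unique h'.choose_spec]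

theorem cost_of_isGap {e : Sym2 (Vert Tok S)} (h : P.IsGap e) : P.cost A f e = -16 * A := by
  have h' : ¬ ∃ q, P.Inner q e := by
    rintro ⟨q, v, w, rfl, hv, hw, -⟩
    exact not_isGap_of_near hv.near hw.near h
  rw [cost, dif_neg h', if_pos h]

theorem near_or_cost_eq (h : ¬ P.IsGap s(v, w)) :
    (∃ s a b, P.Sits v s a ∧ P.Sits w s b ∧ a ≠ b) ∨ P.cost A f s(v, w) = 24 * A := by
  by_cases h' : ∃ q, P.Inner q s(v, w)
  · left
    obtain ⟨⟨s, a, b⟩, v', w', he, hv, hw, hab⟩ := h'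
    rcases Sym2.eq_iff.1 he with ⟨rfl, rfl⟩ | ⟨rfl, rfl⟩
    · exact ⟨s, a, b, hv, hw, hab.ne⟩
    · exact ⟨s, b, a, hw, hv, hab.ne'⟩
  · right
    rw [cost, dif_neg h', if_neg h]

/-- The weight of an edge within a slot is, up to `W`, proportional to the distance. -/
theorem exists_cost_eq (hf : ∀ s a b, |f s a b| ≤ W) (hv : P.Sits v s a) (hw : P.Sits w s b)
    (hab : a ≠ b) : ∃ d, |d| ≤ W ∧ P.cost A f s(v, w) = A * ((a : ℤ) - b).natAbs + d := by
  rcases hab.lt_or_gt with h | h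
  · refine ⟨f s a b, hf s a b, ?_⟩
    rw [cost_of_sits hv hw h]
    congr 2
    omega
  · refine ⟨f s b a, hf s b a, ?_⟩
    rw [Sym2.eq_swap, cost_of_sits hw hv h]
    congr 2
    omega

end SlotSystem

/-! ### Which exchanges can lower the weight -/

namespace SlotSystem

variable {Tok S : Type} {P : SlotSystem Tok S} {σ : Tok → Bool} {v w : Vert Tok S} {s t : S}
  {a b c : ℕ}
variable [Fintype Tok] [Fintype S]

theorem isGap_or_occ_of_mem_tour (h : s(v, w) ∈ P.tour σ) :
    P.IsGap s(v, w) ∨ ∃ s a b, P.Occ σ v s a ∧ P.Occ σ w s b ∧ a ≠ b ∧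
      ∀ z c, P.Occ σ z s c → ¬(a < c ∧ c < b) ∧ ¬(b < c ∧ c < a) := by
  rcases P.mem_tour.1 h with h | ⟨s, a, b, v', w', he, hv, hw, hab, hno⟩
  · exact Or.inl h
  right
  rcases Sym2.eq_iff.1 he with ⟨rfl, rfl⟩ | ⟨rfl, rfl⟩
  · exact ⟨s, a, b, hv, hw, hab.ne, fun z c hz => ⟨fun h => hno z c hz h.1 h.2, by omega⟩⟩
  · exact ⟨s, b, a, hw, hv, hab.ne', fun z c hz => ⟨by omega, fun h => hno z c hz h.1 h.2⟩⟩

variable {A W : ℤ} {f : S → ℕ → ℕ → ℤ}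

/-- All gap edges lie in every such tour, so an added edge is never cheap. -/
theorem not_isGap_of_not_mem {e : Sym2 (Vert Tok S)} (h : e ∉ P.tour σ) : ¬ P.IsGap e :=
  fun h' => h (P.mem_tour.2 (Or.inl h'))

theorem cost_le_of_mem_tour (hA0 : 0 < A) (hf : ∀ s a b, |f s a b| ≤ W)
    {e : Sym2 (Vert Tok S)} (h : e ∈ P.tour σ) : P.cost A f e ≤ 7 * A + W := by
  rcases P.mem_tour.1 h with h | ⟨s, a, b, v, w, rfl, hv, hw, hab, -⟩
  · rw [cost_of_isGap h]
    linarith [(abs_nonneg _).trans (hf (Classical.choose h) 0 0)]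
  · rw [cost_of_sits hv.sits hw.sits hab]
    have h1 : (b : ℤ) - a ≤ 7 := by
      have := hw.sits.le
      omega
    have h2 := mul_le_mul_of_nonneg_left h1 hA0.le
    have h3 := (abs_le.1 (hf s a b)).2
    linarith

omit [Fintype Tok] [Fintype S] in
theorem le_cost_of_not_isGap (hA0 : 0 < A) (hf : ∀ s a b, |f s a b| ≤ W)
    (h : ¬ P.IsGap s(v, w)) : A - W ≤ P.cost A f s(v, w) ∧
      ((∃ s a b, P.Sits v s a ∧ P.Sits w s b ∧ a ≠ b) ∨ P.cost A f s(v, w) = 24 * A) := by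
  refine ⟨?_, near_or_cost_eq h⟩
  rcases near_or_cost_eq (A := A) (f := f) h with ⟨s, a, b, hv, hw, hab⟩ | h
  · obtain ⟨d, hd, h⟩ := exists_cost_eq (A := A) hf hv hw hab
    rw [h]
    have h1 : (1 : ℤ) ≤ ((a : ℤ) - b).natAbs := by omega
    have h2 := mul_le_mul_of_nonneg_left h1 hA0.le
    have h3 := (abs_le.1 hd).1
    linarith
  · rw [h]
    rcases v with x | u
    · linarith [(abs_nonneg _).trans (hf (P.place x true) 0 0)]
    · linarith [(abs_nonneg _).trans (hf u.1 0 0)]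

/-- Once gap edges and expensive edges are excluded, the four edges close up a walk through the
slots, so all of them lie in one slot. There they replace two non-overlapping intervals between
neighbors by edges of larger total length; the excess of at least `2 * A` outweighs the four
perturbations. -/
theorem cost_exchange_le (hA : 6 * W ≤ A) (hA0 : 0 < A) (hf : ∀ s a b, |f s a b| ≤ W)
    {p q r t : Vert Tok S} (hpq : p ≠ q) (hpr : p ≠ r) (hpt : p ≠ t) (hqr : q ≠ r) (hqt : q ≠ t)
    (hrt : r ≠ t) (h₁ : s(p, q) ∈ P.tour σ) (h₂ : s(r, t) ∈ P.tour σ) (h₃ : s(p, r) ∉ P.tour σ)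
    (h₄ : s(q, t) ∉ P.tour σ) :
    P.cost A f s(p, q) + P.cost A f s(r, t) ≤ P.cost A f s(p, r) + P.cost A f s(q, t) := by
  obtain ⟨l₃, c₃⟩ := le_cost_of_not_isGap hA0 hf (not_isGap_of_not_mem h₃)
  obtain ⟨l₄, c₄⟩ := le_cost_of_not_isGap hA0 hf (not_isGap_of_not_mem h₄)
  have u₁ := cost_le_of_mem_tour hA0 hf h₁
  have u₂ := cost_le_of_mem_tour hA0 hf h₂
  rcases isGap_or_occ_of_mem_tour h₁ with h₁ | ⟨s₁, a₁, b₁, p₁, q₁, ab₁, no₁⟩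
  · have := cost_of_isGap (A := A) (f := f) h₁
    linarith
  rcases isGap_or_occ_of_mem_tour h₂ with h₂ | ⟨s₂, a₂, b₂, r₂, t₂, ab₂, no₂⟩
  · have := cost_of_isGap (A := A) (f := f) h₂
    linarith
  rcases c₃ with ⟨s₃, a₃, b₃, p₃, r₃, ab₃⟩ | c₃
  swap
  · linarith
  rcases c₄ with ⟨s₄, a₄, b₄, q₄, t₄, ab₄⟩ | c₄
  swap
  · linarith
  obtain ⟨e₁, e₂, e₃⟩ := Near.four hpq hpt hpr hqt hqr hrt.symm p₃.near p₁.sits.near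
    q₁.sits.near q₄.near t₄.near t₂.sits.near r₂.sits.near r₃.near
  subst e₁ e₂ e₃
  have pe := p₃.pos_unique p₁.sits
  have qe := q₄.pos_unique q₁.sits
  have re := r₃.pos_unique r₂.sits
  have te := t₄.pos_unique t₂.sits
  subst pe qe re te
  obtain ⟨d₁, hd₁, k₁⟩ := exists_cost_eq (A := A) hf p₁.sits q₁.sits ab₁
  obtain ⟨d₂, hd₂, k₂⟩ := exists_cost_eq (A := A) hf r₂.sits t₂.sits ab₂
  obtain ⟨d₃, hd₃, k₃⟩ := exists_cost_eq (A := A) hf p₃ r₃ ab₃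
  obtain ⟨d₄, hd₄, k₄⟩ := exists_cost_eq (A := A) hf q₄ t₄ ab₄
  rw [k₁, k₂, k₃, k₄]
  have n₁ := no₁ _ _ r₂
  have n₂ := no₁ _ _ t₂
  have n₃ := no₂ _ _ p₁
  have n₄ := no₂ _ _ q₁
  have g₁ := p₃.pos_ne t₄ hpt
  have g₂ := q₄.pos_ne r₃ hqr
  have key : ((a₃ : ℤ) - a₄).natAbs + ((b₃ : ℤ) - b₄).natAbs + 2 ≤
      ((a₃ : ℤ) - b₃).natAbs + ((a₄ : ℤ) - b₄).natAbs := by omega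
  have key' := mul_le_mul_of_nonneg_left (Int.ofNat_le.2 key) hA0.le
  push_cast at key'
  rw [abs_le] at hd₁ hd₂ hd₃ hd₄
  push_cast
  linarith

/-- An insertion that lowers the weight moves a token to the position in its other slot. -/
theorem exists_token_of_insertion (hA : 6 * W ≤ A) (hA0 : 0 < A) (hf : ∀ s a b, |f s a b| ≤ W)
    {u v w x y : Vert Tok S} (huv : u ≠ v) (huw : u ≠ w) (hvw : v ≠ w) (hxy : x ≠ y)
    (hxv : x ≠ v) (hyv : y ≠ v) (h₁ : s(u, v) ∈ P.tour σ)
    (h₂ : s(v, w) ∈ P.tour σ) (h₃ : s(x, y) ∈ P.tour σ) (h₄ : s(u, w) ∉ P.tour σ)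
    (h₅ : s(v, x) ∉ P.tour σ) (h₆ : s(v, y) ∉ P.tour σ)
    (hlt : P.cost A f s(u, w) + P.cost A f s(v, x) + P.cost A f s(v, y) <
      P.cost A f s(u, v) + P.cost A f s(v, w) + P.cost A f s(x, y)) :
    ∃ τ a b c d, v = .inl τ ∧ P.Occ σ u (P.place τ (σ τ)) a ∧ P.Occ σ w (P.place τ (σ τ)) b ∧
      P.Occ σ x (P.place τ (!σ τ)) c ∧ P.Occ σ y (P.place τ (!σ τ)) d ∧
      (a < P.pos τ (σ τ) ∧ P.pos τ (σ τ) < b ∨ b < P.pos τ (σ τ) ∧ P.pos τ (σ τ) < a) ∧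
      (c < P.pos τ (!σ τ) ∧ P.pos τ (!σ τ) < d ∨ d < P.pos τ (!σ τ) ∧ P.pos τ (!σ τ) < c) := by
  obtain ⟨l₄, c₄⟩ := le_cost_of_not_isGap hA0 hf (not_isGap_of_not_mem h₄)
  obtain ⟨l₅, c₅⟩ := le_cost_of_not_isGap hA0 hf (not_isGap_of_not_mem h₅)
  obtain ⟨l₆, c₆⟩ := le_cost_of_not_isGap hA0 hf (not_isGap_of_not_mem h₆)
  have u₁ := cost_le_of_mem_tour hA0 hf h₁
  have u₂ := cost_le_of_mem_tour hA0 hf h₂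
  have u₃ := cost_le_of_mem_tour hA0 hf h₃
  rcases isGap_or_occ_of_mem_tour h₁ with h₁ | ⟨s, a, p, hu, hv, ab₁, no₁⟩
  · have := cost_of_isGap (A := A) (f := f) h₁
    linarith
  rcases isGap_or_occ_of_mem_tour h₂ with h₂ | ⟨s', p', b, hv', hw, ab₂, no₂⟩
  · have := cost_of_isGap (A := A) (f := f) h₂
    linarith
  rcases isGap_or_occ_of_mem_tour h₃ with h₃ | ⟨t, c, d, hx, hy, ab₃, no₃⟩
  · have := cost_of_isGap (A := A) (f := f) h₃
    linarith
  obtain ⟨rfl, rfl⟩ := hv.unique hv'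
  obtain ⟨d₁, hd₁, k₁⟩ := exists_cost_eq (A := A) hf hu.sits hv.sits ab₁
  obtain ⟨d₂, hd₂, k₂⟩ := exists_cost_eq (A := A) hf hv.sits hw.sits ab₂
  obtain ⟨d₃, hd₃, k₃⟩ := exists_cost_eq (A := A) hf hx.sits hy.sits ab₃
  have ab₄ := hu.sits.pos_ne hw.sits huw
  obtain ⟨d₄, hd₄, k₄⟩ := exists_cost_eq (A := A) hf hu.sits hw.sits ab₄
  have n₁ := no₁ _ _ hw
  have n₂ := no₂ _ _ hu
  have between : a < p ∧ p < b ∨ b < p ∧ p < a := by omega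
  -- Bypassing `v` does not change the total length in its old slot.
  have key : ((a : ℤ) - p).natAbs + ((p : ℤ) - b).natAbs = ((a : ℤ) - b).natAbs := by omega
  have key' := congrArg (fun n : ℕ => A * (n : ℤ)) key
  have u₁₂ : P.cost A f s(u, v) + P.cost A f s(v, w) ≤ 7 * A + 2 * W := by
    have h7 : ((a : ℤ) - b).natAbs ≤ 7 := by
      have := hu.sits.le
      have := hw.sits.le
      omega
    have h8 := mul_le_mul_of_nonneg_left (Int.ofNat_le.2 h7) hA0.le
    rw [abs_le] at hd₁ hd₂
    push_cast at h8 key'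
    rw [k₁, k₂]
    push_cast
    linarith
  rcases c₅ with ⟨r, q, c', hv₅, hx', ab₅⟩ | c₅
  swap
  · linarith
  rcases c₆ with ⟨r', q', d', hv₆, hy', ab₆⟩ | c₆
  swap
  · linarith
  -- The triangle `v`, `x`, `y` lies in a single slot.
  obtain ⟨e₁, e₂⟩ := Near.three hyv.symm hxv.symm hxy.symm hv₅.near hv₆.near hy'.near
    hy.sits.near hx.sits.near hx'.near
  subst e₁ e₂
  obtain rfl := hv₅.pos_unique hv₆
  obtain rfl := hx'.pos_unique hx.sits
  obtain rfl := hy'.pos_unique hy.sits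
  obtain ⟨d₅, hd₅, k₅⟩ := exists_cost_eq (A := A) hf hv₅ hx' ab₅
  obtain ⟨d₆, hd₆, k₆⟩ := exists_cost_eq (A := A) hf hv₆ hy' ab₆
  -- If `v` were placed outside the interval from `x` to `y`, the detour of at least `2 * A` would
  -- exceed all six perturbations.
  have between' : c' < q ∧ q < d' ∨ d' < q ∧ q < c' := by
    by_contra hcon
    have key₂ : ((c' : ℤ) - d').natAbs + 2 ≤ ((q : ℤ) - c').natAbs + ((q : ℤ) - d').natAbs := by
      omega
    have key₂' := mul_le_mul_of_nonneg_left (Int.ofNat_le.2 key₂) hA0.le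
    rw [abs_le] at hd₁ hd₂ hd₃ hd₄ hd₅ hd₆
    rw [k₁, k₂, k₃, k₄, k₅, k₆] at hlt
    push_cast at key' key₂' hlt
    linarith
  -- The new slot cannot be the old one: `v` already sits there, but nothing sits between `x` and
  -- `y`.
  rcases (hv.sits.near).eq_or hv₅.near with rfl | ⟨τ, β, rfl, h1, h2⟩
  · exfalso
    obtain rfl := hv.sits.pos_unique hv₅
    have := no₃ _ _ hv
    omega
  have hβ : β = σ τ := P.place_ne τ _ _ (h1.trans hv.1.symm)
  subst hβ
  subst h2
  subst h1
  obtain rfl := hv.2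
  obtain ⟨β', h3, rfl⟩ := hv₅
  have hβ' : β' = !σ τ := P.place_ne τ _ _ h3
  subst hβ'
  exact ⟨τ, a, b, c', d', rfl, hu, hw, hx, hy, between, between'⟩

end SlotSystem

/-! ### Moving a token as an insertion -/

namespace SlotSystem

variable {Tok S : Type} {P : SlotSystem Tok S} {σ σ' : Tok → Bool} {τ : Tok}
  {u v w x y : Vert Tok S} {s t : S} {a b c d : ℕ}

variable (P) in
/-- The configurations `σ` and `σ'` differ in the token `τ`. It sits between `u` and `w` in `σ` and
between `x` and `y` in `σ'`. -/
structure IsMove (σ σ' : Tok → Bool) (τ : Tok) (u w x y : Vert Tok S) (a b c d : ℕ) : Prop where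
  eq_of_ne : ∀ z, z ≠ τ → σ' z = σ z
  eq_not : σ' τ = !σ τ
  cons_left : P.Cons σ (P.place τ (σ τ)) a (P.pos τ (σ τ)) u (.inl τ)
  cons_right : P.Cons σ (P.place τ (σ τ)) (P.pos τ (σ τ)) b (.inl τ) w
  cons_new : P.Cons σ (P.place τ (σ' τ)) c d x y
  lt_pos : c < P.pos τ (σ' τ)
  pos_lt : P.pos τ (σ' τ) < d

theorem occ_iff_of_ne (h : ∀ z, z ≠ τ → σ' z = σ z) (hv : v ≠ .inl τ) :
    P.Occ σ' v s a ↔ P.Occ σ v s a := by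
  rcases v with x | r
  · have : σ' x = σ x := h x (by rintro rfl; exact hv rfl)
    simp only [Occ, this]
  · rfl

theorem Occ.eq_of_inl (h : P.Occ σ (.inl τ) s a) : s = P.place τ (σ τ) ∧ a = P.pos τ (σ τ) :=
  ⟨h.1.symm, h.2.symm⟩

namespace IsMove

theorem place_ne (h : P.IsMove σ σ' τ u w x y a b c d) :
    P.place τ (σ τ) ≠ P.place τ (σ' τ) := by
  intro h'
  have := P.place_ne _ _ _ h'
  rw [h.eq_not] at this
  cases h0 : σ τ <;> simp [h0] at this

theorem fst_ne (h : P.IsMove σ σ' τ u w x y a b c d) : u ≠ .inl τ := h.cons_left.ne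

theorem snd_ne (h : P.IsMove σ σ' τ u w x y a b c d) : w ≠ .inl τ := h.cons_right.ne.symm

theorem new_ne (h : P.IsMove σ σ' τ u w x y a b c d) (hv : P.Occ σ v (P.place τ (σ' τ)) c) :
    v ≠ .inl τ := by
  rintro rfl
  exact h.place_ne hv.eq_of_inl.1.symm

theorem fst_new_ne (h : P.IsMove σ σ' τ u w x y a b c d) : x ≠ .inl τ := h.new_ne h.cons_new.1

theorem snd_new_ne (h : P.IsMove σ σ' τ u w x y a b c d) : y ≠ .inl τ := by
  rintro rfl
  exact h.place_ne h.cons_new.2.1.eq_of_inl.1.symm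

theorem cons_old (h : P.IsMove σ σ' τ u w x y a b c d) : P.Cons σ' (P.place τ (σ τ)) a b u w := by
  refine ⟨(occ_iff_of_ne h.eq_of_ne h.fst_ne).2 h.cons_left.1,
    (occ_iff_of_ne h.eq_of_ne h.snd_ne).2 h.cons_right.2.1,
    h.cons_left.2.2.1.trans h.cons_right.2.2.1, ?_⟩
  intro z k hz h1 h2
  have hne : z ≠ .inl τ := by
    rintro rfl
    exact h.place_ne hz.eq_of_inl.1
  rw [occ_iff_of_ne h.eq_of_ne hne] at hz
  rcases lt_trichotomy k (P.pos τ (σ τ)) with h3 | h3 | h3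
  · exact h.cons_left.2.2.2 z k hz h1 h3
  · subst h3
    exact hne (hz.sits.vert_unique h.cons_left.2.1.sits)
  · exact h.cons_right.2.2.2 z k hz h3 h2

theorem cons_new_left (h : P.IsMove σ σ' τ u w x y a b c d) :
    P.Cons σ' (P.place τ (σ' τ)) c (P.pos τ (σ' τ)) x (.inl τ) := by
  refine ⟨(occ_iff_of_ne h.eq_of_ne h.fst_new_ne).2 h.cons_new.1, ⟨rfl, rfl⟩, h.lt_pos, ?_⟩
  intro z k hz h1 h2
  have hne : z ≠ .inl τ := by
    rintro rfl
    exact h2.ne hz.eq_of_inl.2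
  rw [occ_iff_of_ne h.eq_of_ne hne] at hz
  exact h.cons_new.2.2.2 z k hz h1 (h2.trans h.pos_lt)

theorem cons_new_right (h : P.IsMove σ σ' τ u w x y a b c d) :
    P.Cons σ' (P.place τ (σ' τ)) (P.pos τ (σ' τ)) d (.inl τ) y := by
  refine ⟨⟨rfl, rfl⟩, (occ_iff_of_ne h.eq_of_ne h.snd_new_ne).2 h.cons_new.2.1, h.pos_lt, ?_⟩
  intro z k hz h1 h2
  have hne : z ≠ .inl τ := by
    rintro rfl
    exact h1.ne' hz.eq_of_inl.2
  rw [occ_iff_of_ne h.eq_of_ne hne] at hz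
  exact h.cons_new.2.2.2 z k hz (h.lt_pos.trans h1) h2

/-- Reversing the move turns facts about removed edges into facts about added ones. -/
theorem symm (h : P.IsMove σ σ' τ u w x y a b c d) : P.IsMove σ' σ τ x y u w c d a b where
  eq_of_ne z hz := (h.eq_of_ne z hz).symm
  eq_not := by rw [h.eq_not, Bool.not_not]
  cons_left := h.cons_new_left
  cons_right := h.cons_new_right
  cons_new := h.cons_old
  lt_pos := h.cons_left.2.2.1
  pos_lt := h.cons_right.2.2.1

section Fintype

variable [Fintype Tok] [Fintype S]

/-- An edge not meeting `τ` is destroyed only when `τ` lands between its ends, which are then `x`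
and `y`. -/
theorem mem_tour (h : P.IsMove σ σ' τ u w x y a b c d) {e : Sym2 (Vert Tok S)}
    (he : e ∈ P.tour σ) (h₁ : e ≠ s(u, .inl τ)) (h₂ : e ≠ s(.inl τ, w)) (h₃ : e ≠ s(x, y)) :
    e ∈ P.tour σ' := by
  rw [SlotSystem.mem_tour] at he ⊢
  rcases he with he | ⟨r, k, l, p, q, rfl, hp, hq, hkl, hno⟩
  · exact Or.inl he
  right
  have hpn : p ≠ .inl τ := by
    rintro rfl
    obtain ⟨rfl, rfl⟩ := hp.eq_of_inl
    have hl : l = b := by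
      rcases lt_trichotomy l b with h1 | h1 | h1
      · exact (h.cons_right.2.2.2 q l hq hkl h1).elim
      · exact h1
      · exact (hno w b h.cons_right.2.1 h.cons_right.2.2.1 h1).elim
    subst hl
    rw [hq.sits.vert_unique h.cons_right.2.1.sits] at h₂
    exact h₂ rfl
  have hqn : q ≠ .inl τ := by
    rintro rfl
    obtain ⟨rfl, rfl⟩ := hq.eq_of_inl
    have hk : k = a := by
      rcases lt_trichotomy k a with h1 | h1 | h1
      · exact (hno u a h.cons_left.1 h1 h.cons_left.2.2.1).elim
      · exact h1
      · exact (h.cons_left.2.2.2 p k hp h1 hkl).elim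
    subst hk
    rw [hp.sits.vert_unique h.cons_left.1.sits] at h₁
    exact h₁ rfl
  refine ⟨r, k, l, p, q, rfl, (occ_iff_of_ne h.eq_of_ne hpn).2 hp,
    (occ_iff_of_ne h.eq_of_ne hqn).2 hq, hkl, ?_⟩
  intro z j hz hkj hjl
  by_cases hzn : z = .inl τ
  · subst hzn
    obtain ⟨rfl, rfl⟩ := hz.eq_of_inl
    have hk : k = c := by
      rcases lt_trichotomy k c with h1 | h1 | h1
      · exact (hno x c h.cons_new.1 h1 (h.lt_pos.trans hjl)).elim
      · exact h1
      · exact (h.cons_new.2.2.2 p k hp h1 (hkj.trans h.pos_lt)).elim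
    have hl : l = d := by
      rcases lt_trichotomy l d with h1 | h1 | h1
      · exact (h.cons_new.2.2.2 q l hq (h.lt_pos.trans hjl) h1).elim
      · exact h1
      · exact (hno y d h.cons_new.2.1 (hkj.trans h.pos_lt) h1).elim
    subst hk hl
    rw [hp.sits.vert_unique h.cons_new.1.sits, hq.sits.vert_unique h.cons_new.2.1.sits] at h₃
    exact h₃ rfl
  · rw [occ_iff_of_ne h.eq_of_ne hzn] at hz
    exact hno z j hz hkj hjl

theorem left_not_mem (h : P.IsMove σ σ' τ u w x y a b c d) (hv : v ≠ .inl τ)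
    (hvs : P.Occ σ v (P.place τ (σ τ)) a) : s(v, .inl τ) ∉ P.tour σ' := by
  intro hm
  rcases isGap_or_occ_of_mem_tour hm with hm | ⟨r, k, l, hr, hl, -⟩
  · exact not_isGap_of_near hvs.sits.near h.cons_left.2.1.sits.near hm
  · obtain ⟨rfl, rfl⟩ := hl.eq_of_inl
    rw [occ_iff_of_ne h.eq_of_ne hv] at hr
    exact h.place_ne (hvs.unique hr).1

theorem new_not_mem (h : P.IsMove σ σ' τ u w x y a b c d) : s(x, y) ∉ P.tour σ' := by
  intro hm
  rcases isGap_or_occ_of_mem_tour hm with hm | ⟨r, k, l, hr, hl, -, hno⟩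
  · exact not_isGap_of_near h.cons_new.1.sits.near h.cons_new.2.1.sits.near hm
  · obtain ⟨rfl, rfl⟩ := hr.unique h.cons_new_left.1
    obtain ⟨-, rfl⟩ := hl.unique h.cons_new_right.2.1
    exact (hno _ _ h.cons_new_left.2.1).1 ⟨h.lt_pos, h.pos_lt⟩

variable [DecidableEq Tok] [DecidableEq S]

theorem old_subset (h : P.IsMove σ σ' τ u w x y a b c d) :
    {s(u, .inl τ), s(.inl τ, w), s(x, y)} ⊆ P.tour σ := by
  intro e he
  simp only [mem_insert, mem_singleton] at he
  rw [SlotSystem.mem_tour]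
  right
  rcases he with rfl | rfl | rfl
  · exact ⟨_, _, _, _, _, rfl, h.cons_left⟩
  · exact ⟨_, _, _, _, _, rfl, h.cons_right⟩
  · exact ⟨_, _, _, _, _, rfl, h.cons_new⟩

theorem old_disjoint (h : P.IsMove σ σ' τ u w x y a b c d) {e : Sym2 (Vert Tok S)}
    (he : e ∈ ({s(u, .inl τ), s(.inl τ, w), s(x, y)} : Finset _)) : e ∉ P.tour σ' := by
  simp only [mem_insert, mem_singleton] at he
  rcases he with rfl | rfl | rfl
  · exact h.left_not_mem h.fst_ne h.cons_left.1
  · rw [Sym2.eq_swap]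
    intro hm
    rcases isGap_or_occ_of_mem_tour hm with hm | ⟨r, k, l, hr, hl, -⟩
    · exact not_isGap_of_near h.cons_right.2.1.sits.near h.cons_right.1.sits.near hm
    · obtain ⟨rfl, rfl⟩ := hl.eq_of_inl
      rw [occ_iff_of_ne h.eq_of_ne h.snd_ne] at hr
      exact h.place_ne (h.cons_right.2.1.unique hr).1
  · exact h.new_not_mem

omit [Fintype Tok] [Fintype S] in
theorem new_edges_eq : ({s(x, .inl τ), s(.inl τ, y), s(u, w)} : Finset (Sym2 (Vert Tok S))) =
    {s(u, w), s(.inl τ, x), s(.inl τ, y)} := by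
  ext e
  simp only [mem_insert, mem_singleton, Sym2.eq_swap (a := x)]
  tauto

theorem tour_eq (h : P.IsMove σ σ' τ u w x y a b c d) :
    P.tour σ' = (P.tour σ \ {s(u, .inl τ), s(.inl τ, w), s(x, y)}) ∪
      {s(u, w), s(.inl τ, x), s(.inl τ, y)} := by
  ext e
  rw [mem_union, mem_sdiff, ← new_edges_eq]
  constructor
  · intro he
    by_cases hn : e ∈ ({s(x, .inl τ), s(.inl τ, y), s(u, w)} : Finset _)
    · exact Or.inr hn
    · left
      refine ⟨?_, fun h' => h.old_disjoint h' he⟩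
      simp only [mem_insert, mem_singleton, not_or] at hn
      exact h.symm.mem_tour he hn.1 hn.2.1 hn.2.2
  · rintro (⟨h1, h2⟩ | h1)
    · simp only [mem_insert, mem_singleton, not_or] at h2
      exact h.mem_tour h1 h2.1 h2.2.1 h2.2.2
    · exact h.symm.old_subset h1

omit [Fintype Tok] [Fintype S] in
theorem card_old (h : P.IsMove σ σ' τ u w x y a b c d) :
    ({s(u, .inl τ), s(.inl τ, w), s(x, y)} : Finset (Sym2 (Vert Tok S))).card = 3 := by
  refine card_eq_three.2 ⟨_, _, _, ?_, ?_, ?_, rfl⟩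
  · intro he
    have := h.cons_old.ne
    rcases Sym2.eq_iff.1 he with ⟨h1, -⟩ | ⟨h1, -⟩
    · exact h.fst_ne h1
    · exact this h1
  · intro he
    rcases Sym2.eq_iff.1 he with ⟨-, h1⟩ | ⟨-, h1⟩
    · exact h.snd_new_ne h1.symm
    · exact h.fst_new_ne h1.symm
  · intro he
    rcases Sym2.eq_iff.1 he with ⟨h1, -⟩ | ⟨h1, -⟩
    · exact h.fst_new_ne h1.symm
    · exact h.snd_new_ne h1.symm

theorem isTwoHalfSwap (h : P.IsMove σ σ' τ u w x y a b c d) :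
    TSPInstance.IsTwoHalfSwap ({s(u, .inl τ), s(.inl τ, w), s(x, y)} : Finset (Sym2 (Vert Tok S)))
      {s(u, w), s(.inl τ, x), s(.inl τ, y)} := by
  refine ⟨⟨fun e he => (P.isTour_tour σ).not_isDiag (h.old_subset he), fun e he => ?_, ?_⟩, ?_⟩
  · rw [← new_edges_eq] at he
    exact (P.isTour_tour σ').not_isDiag (h.symm.old_subset he)
  · rw [← new_edges_eq, h.card_old, h.symm.card_old]
  · right
    refine ⟨h.card_old, s(u, .inl τ), by simp, s(.inl τ, w), by simp, ?_, .inl τ, by simp, by simp⟩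
    intro he
    have := h.cons_old.ne
    rcases Sym2.eq_iff.1 he with ⟨h1, -⟩ | ⟨h1, -⟩
    · exact h.fst_ne h1
    · exact this h1

end Fintype

end IsMove

/-- The backbone vertices at positions 0 and 7 guarantee neighbors on both sides in either slot. -/
theorem exists_isMove [DecidableEq Tok] (P : SlotSystem Tok S) (σ : Tok → Bool) (τ : Tok) :
    ∃ u w x y a b c d, P.IsMove σ (Function.update σ τ (!σ τ)) τ u w x y a b c d := by
  obtain ⟨a, u, hu, ha, hua⟩ := exists_last_before (P := P) (σ := σ) (s := P.place τ (σ τ))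
    (P.one_le_pos τ (σ τ))
  obtain ⟨b, w, hw, hb, hwb⟩ := exists_first_after (P := P) (σ := σ) (s := P.place τ (σ τ))
    ((P.pos_le τ (σ τ)).trans_lt (by norm_num))
  obtain ⟨c, x, hx, hc, hxc⟩ := exists_last_before (P := P) (σ := σ) (s := P.place τ (!σ τ))
    (P.one_le_pos τ (!σ τ))
  obtain ⟨d, y, hy, hd, hyd⟩ := exists_first_after (P := P) (σ := σ) (s := P.place τ (!σ τ))
    ((P.pos_le τ (!σ τ)).trans_lt (by norm_num))
  have hself : Function.update σ τ (!σ τ) τ = !σ τ := Function.update_self ..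
  refine ⟨u, w, x, y, a, b, c, d, fun z hz => Function.update_of_ne hz .., hself,
    ⟨hu, ⟨rfl, rfl⟩, ha, hua⟩, ⟨⟨rfl, rfl⟩, hw, hb, hwb⟩, ?_, ?_, ?_⟩
  · rw [hself]
    refine ⟨hx, hy, hc.trans hd, ?_⟩
    intro z k hz h1 h2
    rcases lt_trichotomy k (P.pos τ (!σ τ)) with h3 | rfl | h3
    · exact hxc z k hz h1 h3
    · have : z = .inl τ := hz.sits.vert_unique ⟨!σ τ, rfl, rfl⟩
      subst this
      have := P.place_ne _ _ _ hz.1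
      cases h0 : σ τ <;> simp [h0] at this
    · exact hyd z k hz h3 h2
  · rwa [hself]
  · rwa [hself]

end SlotSystem

/-! ### Improving 2.5-swaps are token moves -/

namespace SlotSystem

variable {Tok S : Type} {P : SlotSystem Tok S} {σ : Tok → Bool} {τ : Tok}
  {u v w x y : Vert Tok S} {s : S} {a b c d : ℕ}
variable [Fintype Tok] [Fintype S]

theorem Occ.cons (hv : P.Occ σ v s a) (hw : P.Occ σ w s b) (hab : a < b)
    (h : s(v, w) ∈ P.tour σ) : P.Cons σ s a b v w := by
  rcases isGap_or_occ_of_mem_tour h with h | ⟨t, k, l, h1, h2, -, hno⟩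
  · exact (not_isGap_of_near hv.sits.near hw.sits.near h).elim
  · obtain ⟨rfl, rfl⟩ := hv.unique h1
    obtain ⟨-, rfl⟩ := hw.unique h2
    exact ⟨hv, hw, hab, fun z c hz h3 h4 => (hno z c hz).1 ⟨h3, h4⟩⟩

variable [DecidableEq Tok] [DecidableEq S] {A W : ℤ} {f : S → ℕ → ℕ → ℤ}

theorem insertion_eq_tour {T' : Finset (Sym2 (Vert Tok S))}
    (hu : P.Occ σ u (P.place τ (σ τ)) a) (hw : P.Occ σ w (P.place τ (σ τ)) b)
    (hx : P.Occ σ x (P.place τ (!σ τ)) c) (hy : P.Occ σ y (P.place τ (!σ τ)) d)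
    (ha : a < P.pos τ (σ τ)) (hb : P.pos τ (σ τ) < b) (hc : c < P.pos τ (!σ τ))
    (hd : P.pos τ (!σ τ) < d) (h₁ : s(u, .inl τ) ∈ P.tour σ) (h₂ : s(.inl τ, w) ∈ P.tour σ)
    (h₃ : s(x, y) ∈ P.tour σ) (hT' : T' = (P.tour σ \ {s(u, .inl τ), s(.inl τ, w), s(x, y)}) ∪
      {s(u, w), s(.inl τ, x), s(.inl τ, y)}) :
    T' = P.tour (Function.update σ τ (!σ τ)) := by
  have hv : P.Occ σ (.inl τ) (P.place τ (σ τ)) (P.pos τ (σ τ)) := ⟨rfl, rfl⟩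
  have hself : Function.update σ τ (!σ τ) τ = !σ τ := Function.update_self ..
  have h : P.IsMove σ (Function.update σ τ (!σ τ)) τ u w x y a b c d :=
    { eq_of_ne := fun z hz => Function.update_of_ne hz ..
      eq_not := hself
      cons_left := hu.cons hv ha h₁
      cons_right := hv.cons hw hb h₂
      cons_new := by rw [hself]; exact hx.cons hy (hc.trans hd) h₃
      lt_pos := by rwa [hself]
      pos_lt := by rwa [hself] }
  rw [hT', h.tour_eq]

/-- A 2.5-swap on the tour of a configuration that lowers the weight moves one token. -/
theorem exists_eq_tour_update (hA : 6 * W ≤ A) (hA0 : 0 < A) (hf : ∀ s a b, |f s a b| ≤ W)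
    {T' E₁ E₂ : Finset (Sym2 (Vert Tok S))} (hT' : TSPInstance.IsTour T')
    (hE : TSPInstance.IsTwoHalfSwap E₁ E₂) (h : T' = (P.tour σ \ E₁) ∪ E₂)
    (hlt : ∑ e ∈ T', P.cost A f e < ∑ e ∈ P.tour σ, P.cost A f e) :
    ∃ τ, T' = P.tour (Function.update σ τ (!σ τ)) := by
  have hne : P.tour σ ≠ T' := by
    intro h'
    rw [h'] at hlt
    exact lt_irrefl _ hlt
  have hdiff := sum_sdiff_sub_sum_sdiff (s₁ := P.tour σ) (s₂ := T') (f := P.cost A f)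
  have hrec : T' = (P.tour σ \ (P.tour σ \ T')) ∪ (T' \ P.tour σ) := by
    ext e
    simp only [mem_union, mem_sdiff]
    tauto
  have old : ∀ e ∈ P.tour σ \ T', e ∈ P.tour σ := fun e he => (mem_sdiff.1 he).1
  have new : ∀ e ∈ T' \ P.tour σ, e ∉ P.tour σ := fun e he => (mem_sdiff.1 he).2
  rcases TSPInstance.exchange_or_insertion_of_swap (P.isTour_tour σ) hT' hE h hne with
    ⟨p, q, r, t, hO, hN, hpq, hpr, hpt, hqr, hqt, hrt⟩ |
    ⟨u, v, w, x, y, hO, hN, huv, huw, hvw, hxy, hxu, hxv, hxw, hyu, hyv, hyw⟩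
  · exfalso
    rw [hO] at old hdiff
    rw [hN] at new hdiff
    have h1 := cost_exchange_le (f := f) hA hA0 hf hpq hpr hpt hqr hqt hrt (old _ (by simp))
      (old _ (by simp)) (new _ (by simp)) (new _ (by simp))
    rw [sum_pair, sum_pair] at hdiff
    · linarith
    · simp only [ne_eq, Sym2.eq_iff]
      tauto
    · simp only [ne_eq, Sym2.eq_iff]
      tauto
  · rw [hO] at old hdiff
    rw [hN] at new hdiff
    rw [hO, hN] at hrec
    have m₁ := old s(u, v) (by simp)
    have m₂ := old s(v, w) (by simp)
    have m₃ := old s(x, y) (by simp)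
    have hcost : P.cost A f s(u, w) + P.cost A f s(v, x) + P.cost A f s(v, y) <
        P.cost A f s(u, v) + P.cost A f s(v, w) + P.cost A f s(x, y) := by
      rw [sum_insert, sum_pair, sum_insert, sum_pair] at hdiff
      · linarith
      all_goals
        simp only [ne_eq, mem_insert, mem_singleton, Sym2.eq_iff]
        grind
    obtain ⟨τ, a, b, c, d, rfl, hu, hw, hx, hy, hab, hcd⟩ := exists_token_of_insertion hA hA0 hf
      huv huw hvw hxy hxv hyv m₁ m₂ m₃ (new _ (by simp)) (new _ (by simp)) (new _ (by simp)) hcost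
    refine ⟨τ, ?_⟩
    rcases hab with ⟨ha, hb⟩ | ⟨hb, ha⟩ <;> rcases hcd with ⟨hc, hd⟩ | ⟨hd, hc⟩
    · exact insertion_eq_tour hu hw hx hy ha hb hc hd m₁ m₂ m₃ hrec
    · refine insertion_eq_tour hu hw hy hx ha hb hd hc m₁ m₂ (by rwa [Sym2.eq_swap]) ?_
      rw [hrec, Sym2.eq_swap (a := y), pair_comm s(.inl τ, x)]
    · refine insertion_eq_tour hw hu hx hy hb ha hc hd (by rwa [Sym2.eq_swap])
        (by rwa [Sym2.eq_swap]) m₃ ?_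
      rw [hrec, Sym2.eq_swap (a := w), Sym2.eq_swap (a := w), Sym2.eq_swap (b := u),
        insert_comm s(u, _)]
    · refine insertion_eq_tour hw hu hy hx hb ha hd hc (by rwa [Sym2.eq_swap])
        (by rwa [Sym2.eq_swap]) (by rwa [Sym2.eq_swap]) ?_
      rw [hrec, Sym2.eq_swap (a := w), Sym2.eq_swap (a := w), Sym2.eq_swap (b := u),
        insert_comm s(u, _), Sym2.eq_swap (a := y), pair_comm s(.inl τ, x)]

/-- Moving a token is a 2.5-swap. -/
theorem exists_swap_update (P : SlotSystem Tok S) (σ : Tok → Bool) (τ : Tok) :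
    ∃ E₁ E₂ : Finset (Sym2 (Vert Tok S)), TSPInstance.IsTwoHalfSwap E₁ E₂ ∧ E₁ ⊆ P.tour σ ∧
      P.tour (Function.update σ τ (!σ τ)) = (P.tour σ \ E₁) ∪ E₂ := by
  obtain ⟨u, w, x, y, a, b, c, d, h⟩ := P.exists_isMove σ τ
  exact ⟨_, _, h.isTwoHalfSwap, h.old_subset, h.tour_eq⟩

end SlotSystem

/-! ### The weight of a tour as an energy -/

/-- The filled positions `a < b` are consecutive. -/
def ConsecutivePos (o : Fin 8 → Bool) (a b : Fin 8) : Prop :=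
  o a ∧ o b ∧ a < b ∧ ∀ c, a < c → c < b → o c = false

instance (o : Fin 8 → Bool) (a b : Fin 8) : Decidable (ConsecutivePos o a b) :=
  inferInstanceAs (Decidable (_ ∧ _))

/-- The gaps between filled positions telescope from 0 to 7. -/
theorem sum_consecutivePos : ∀ o : Fin 8 → Bool, o 0 = true → o 7 = true →
    (∑ a, ∑ b, if ConsecutivePos o a b then b.val - a.val else 0) = 7 := by
  decide +kernel

namespace SlotSystem

variable {Tok S : Type} {P : SlotSystem Tok S} {σ : Tok → Bool} {s : S}
  {A : ℤ} {f : S → ℕ → ℕ → ℤ}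

variable (P σ s) in
/-- Whether a position of a slot is occupied. -/
noncomputable def filled (a : Fin 8) : Bool := by
  classical
  exact decide (∃ v, P.Occ σ v s a)

theorem filled_eq_true {a : Fin 8} : P.filled σ s a = true ↔ ∃ v, P.Occ σ v s a := by
  simp [filled]

theorem filled_zero : P.filled σ s 0 = true := filled_eq_true.2 ⟨_, P.occ_left σ s⟩

theorem filled_seven : P.filled σ s 7 = true := filled_eq_true.2 ⟨_, P.occ_right σ s⟩

theorem consecutivePos_filled_iff {a b : Fin 8} :
    ConsecutivePos (P.filled σ s) a b ↔ ∃ v w, P.Cons σ s a b v w := by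
  constructor
  · rintro ⟨ha, hb, hab, hno⟩
    obtain ⟨v, hv⟩ := filled_eq_true.1 ha
    obtain ⟨w, hw⟩ := filled_eq_true.1 hb
    refine ⟨v, w, hv, hw, hab, fun z c hz h1 h2 => ?_⟩
    have hc : c < 8 := by omega
    have := hno ⟨c, hc⟩ h1 h2
    rw [filled_eq_true.2 ⟨z, hz⟩] at this
    exact Bool.noConfusion this
  · rintro ⟨v, w, hv, hw, hab, hno⟩
    refine ⟨filled_eq_true.2 ⟨v, hv⟩, filled_eq_true.2 ⟨w, hw⟩, hab, fun c h1 h2 => ?_⟩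
    rw [Bool.eq_false_iff, Ne, filled_eq_true]
    rintro ⟨z, hz⟩
    exact hno z c hz h1 h2

variable [Fintype S]

variable (P) in
/-- The energy of a configuration. -/
noncomputable def energy (f : S → ℕ → ℕ → ℤ) (σ : Tok → Bool) : ℤ :=
  ∑ s, ∑ a : Fin 8, ∑ b : Fin 8, if ConsecutivePos (P.filled σ s) a b then f s a b else 0

/-- Each slot contributes a total length of `7 * A` and one gap edge of `-16 * A`, whatever the
configuration. -/
theorem sum_tour_eq [Fintype Tok] (P : SlotSystem Tok S) (σ : Tok → Bool) (A : ℤ) (f : S → ℕ → ℕ → ℤ) :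
    ∑ e ∈ P.tour σ, P.cost A f e = -9 * A * Fintype.card S + P.energy f σ := by
  classical
  rw [← sum_filter_add_sum_filter_not (P.tour σ) P.IsGap]
  have h1 : ∑ e ∈ P.tour σ with P.IsGap e, P.cost A f e = ∑ s : S, -16 * A := by
    symm
    refine sum_bij (fun s _ => s(.inr (s, true), .inr (P.next s, false))) ?_ ?_ ?_ ?_
    · intro s _
      rw [mem_filter, mem_tour]
      exact ⟨Or.inl ⟨s, rfl⟩, s, rfl⟩
    · intro s _ t _ h
      rcases Sym2.eq_iff.1 h with ⟨h, -⟩ | ⟨h, -⟩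
      · simpa using h
      · simp at h
    · intro e he
      obtain ⟨s, rfl⟩ := (mem_filter.1 he).2
      exact ⟨s, mem_univ _, rfl⟩
    · intro s _
      rw [cost_of_isGap ⟨s, rfl⟩]
  have h2 : ∑ e ∈ P.tour σ with ¬ P.IsGap e, P.cost A f e =
      ∑ q : S × Fin 8 × Fin 8 with ConsecutivePos (P.filled σ q.1) q.2.1 q.2.2,
        (A * ((q.2.2.val : ℤ) - q.2.1.val) + f q.1 q.2.1 q.2.2) := by
    symm
    have hc : ∀ q : S × Fin 8 × Fin 8,
        q ∈ univ.filter (fun q : S × Fin 8 × Fin 8 =>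
          ConsecutivePos (P.filled σ q.1) q.2.1 q.2.2) →
        ∃ e : Sym2 (Vert Tok S), ∃ v w, e = s(v, w) ∧ P.Cons σ q.1 q.2.1 q.2.2 v w := by
      intro q hq
      obtain ⟨v, w, h⟩ := consecutivePos_filled_iff.1 (mem_filter.1 hq).2
      exact ⟨_, v, w, rfl, h⟩
    choose g hg using hc
    have hinner : ∀ q hq, P.Inner (q.1, q.2.1.val, q.2.2.val) (g q hq) := by
      intro q hq
      obtain ⟨v, w, h, hv, hw, hab, -⟩ := hg q hq
      exact ⟨v, w, h, hv.sits, hw.sits, hab⟩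
    refine sum_bij (fun q hq => g q hq) ?_ ?_ ?_ ?_
    · intro q hq
      obtain ⟨v, w, h, hc⟩ := hg q hq
      rw [mem_filter, mem_tour]
      refine ⟨Or.inr ⟨_, _, _, v, w, h, hc⟩, ?_⟩
      rw [h]
      exact not_isGap_of_near hc.1.sits.near hc.2.1.sits.near
    · intro q hq q' hq' h
      have h1 := hinner q hq
      rw [h] at h1
      have h2 := h1.unique (hinner q' hq')
      simp only [Prod.mk.injEq] at h2
      exact Prod.ext h2.1 (Prod.ext (Fin.ext h2.2.1) (Fin.ext h2.2.2))
    · intro e he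
      rw [mem_filter, mem_tour] at he
      rcases he with ⟨he | ⟨s, a, b, v, w, rfl, hc⟩, hn⟩
      · exact (hn he).elim
      have ha : a < 8 := by have := hc.1.sits.le; omega
      have hb : b < 8 := by have := hc.2.1.sits.le; omega
      have hm : (s, (⟨a, ha⟩ : Fin 8), (⟨b, hb⟩ : Fin 8)) ∈ univ.filter
          (fun q : S × Fin 8 × Fin 8 => ConsecutivePos (P.filled σ q.1) q.2.1 q.2.2) :=
        mem_filter.2 ⟨mem_univ _, consecutivePos_filled_iff.2 ⟨v, w, hc⟩⟩
      refine ⟨_, hm, ?_⟩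
      obtain ⟨v', w', h, hc'⟩ := hg _ hm
      rw [h, hc'.1.sits.vert_unique hc.1.sits, hc'.2.1.sits.vert_unique hc.2.1.sits]
    · intro q hq
      obtain ⟨v, w, h, hv, hw, hab, -⟩ := hg q hq
      rw [h, cost_of_sits hv.sits hw.sits hab]
  have h3 : ∀ s : S, (∑ a : Fin 8, ∑ b : Fin 8, if ConsecutivePos (P.filled σ s) a b then
      A * ((b.val : ℤ) - a.val) + f s a b else 0) = 7 * A +
      ∑ a : Fin 8, ∑ b : Fin 8, if ConsecutivePos (P.filled σ s) a b then f s a b else 0 := by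
    intro s
    have h4 := congrArg (fun n : ℕ => A * (n : ℤ))
      (sum_consecutivePos _ (filled_zero (P := P) (σ := σ) (s := s)) filled_seven)
    simp only [Nat.cast_sum, mul_sum] at h4
    have h5 : (7 : ℤ) * A = A * (7 : ℕ) := by push_cast; ring
    rw [h5, ← h4, ← sum_add_distrib]
    refine sum_congr rfl fun a _ => ?_
    rw [← sum_add_distrib]
    refine sum_congr rfl fun b _ => ?_
    split_ifs with h
    · rw [Nat.cast_sub h.2.2.1.le]
    · simp
  rw [h1, h2, sum_filter, Fintype.sum_prod_type]
  simp_rw [Fintype.sum_prod_type, h3]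
  rw [sum_add_distrib, sum_const, sum_const, energy, card_univ, nsmul_eq_mul, nsmul_eq_mul]
  ring

end SlotSystem

/-! ### From an energy to a metric TSP instance -/

namespace SlotSystem

variable {Tok S : Type} [Fintype Tok] [Fintype S] [DecidableEq Tok] [DecidableEq S]

section Instance

variable {R : Type} [AddCommMonoid R] [LinearOrder R]

/-- The TSP instance of a slot system, with weights shifted by `B`. -/
noncomputable def tspInstance (P : SlotSystem Tok S) (φ : ℤ →+ R) (A B : ℤ)
    (f : S → ℕ → ℕ → ℤ) : TSPInstance R where
  V := Vert Tok S
  c e := φ (P.cost A f e + B)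

omit [LinearOrder R] in
theorem weight_tspInstance (P : SlotSystem Tok S) (φ : ℤ →+ R) (A B : ℤ) (f : S → ℕ → ℕ → ℤ)
    {T : Finset (Sym2 (Vert Tok S))} (hT : TSPInstance.IsTour T) :
    (P.tspInstance φ A B f).weight T =
      φ (∑ e ∈ T, P.cost A f e + Fintype.card (Vert Tok S) * B) := by
  have : (P.tspInstance φ A B f).weight T = ∑ e ∈ T, φ (P.cost A f e + B) := rfl
  rw [this, ← map_sum, sum_add_distrib, sum_const, hT.card_eq, nsmul_eq_mul]

theorem weight_tspInstance_lt_iff (P : SlotSystem Tok S) {φ : ℤ →+ R} (hφ : StrictMono φ)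
    (A B : ℤ) (f : S → ℕ → ℕ → ℤ) {T T' : Finset (Sym2 (Vert Tok S))}
    (hT : TSPInstance.IsTour T) (hT' : TSPInstance.IsTour T') :
    (P.tspInstance φ A B f).weight T < (P.tspInstance φ A B f).weight T' ↔
      ∑ e ∈ T, P.cost A f e < ∑ e ∈ T', P.cost A f e := by
  rw [P.weight_tspInstance φ A B f hT, P.weight_tspInstance φ A B f hT', hφ.lt_iff_lt,
    add_lt_add_iff_right]

/-- The shift dominates the spread of the costs: `M + B ≤ 2 * (B - M)`. -/
theorem isMetric_tspInstance (P : SlotSystem Tok S) {φ : ℤ →+ R} (hφ : StrictMono φ) {A B M : ℤ}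
    {f : S → ℕ → ℕ → ℤ} (hM : ∀ e, |P.cost A f e| ≤ M) (hB : 3 * M ≤ B) :
    (P.tspInstance φ A B f).IsMetric := by
  intro x y z _ _ _
  change φ (P.cost A f s(x, z) + B) ≤ φ (P.cost A f s(x, y) + B) + φ (P.cost A f s(y, z) + B)
  rw [← map_add]
  apply hφ.monotone
  have h1 := abs_le.1 (hM s(x, z))
  have h2 := abs_le.1 (hM s(x, y))
  have h3 := abs_le.1 (hM s(y, z))
  linarith

/-- If every improving flip of a token lowers the energy by at most one and the energy is at most
`E` when there is none, then every execution of the 2.5-opt algorithm takes as many iterations as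
the difference of the initial energy and `E`. -/
theorem exists_instance {φ : ℤ →+ R} (hφ : StrictMono φ) (P : SlotSystem Tok S)
    (f : S → ℕ → ℕ → ℤ) (Inv : (Tok → Bool) → Prop) {σ₀ : Tok → Bool} (h₀ : Inv σ₀) (E : ℤ)
    (hstep : ∀ σ τ, Inv σ → P.energy f (Function.update σ τ (!σ τ)) < P.energy f σ →
      Inv (Function.update σ τ (!σ τ)) ∧
        P.energy f σ - 1 ≤ P.energy f (Function.update σ τ (!σ τ)))
    (hstuck : ∀ σ, Inv σ → (∀ τ, P.energy f σ ≤ P.energy f (Function.update σ τ (!σ τ))) →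
      P.energy f σ ≤ E) :
    ∃ I : TSPInstance R, I.IsMetric ∧
      Fintype.card I.V = Fintype.card Tok + Fintype.card S * 2 ∧
      ∃ s : (tspTwoHalfOpt R).Sol I, ∀ l x, (tspTwoHalfOpt R).IsExecution I s l x →
        P.energy f σ₀ - E ≤ l := by
  classical
  -- Only positions below 8 occur; truncation makes the perturbation bounded without changing the
  -- energy.
  let f' : S → ℕ → ℕ → ℤ := fun s a b => if a < 8 ∧ b < 8 then f s a b else 0
  have hen : ∀ σ, P.energy f' σ = P.energy f σ := by
    intro σ
    refine sum_congr rfl fun s _ => sum_congr rfl fun a _ => sum_congr rfl fun b _ => ?_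
    simp [f']
  obtain ⟨W, hW⟩ : ∃ W, ∀ s a b, |f' s a b| ≤ W := by
    refine ⟨∑ s : S, ∑ a ∈ range 8, ∑ b ∈ range 8, |f s a b|, fun s a b => ?_⟩
    have hnn : ∀ s : S, 0 ≤ ∑ a ∈ range 8, ∑ b ∈ range 8, |f s a b| := fun s =>
      sum_nonneg fun a _ => sum_nonneg fun b _ => abs_nonneg _
    by_cases h : a < 8 ∧ b < 8
    · simp only [f', if_pos h]
      calc |f s a b| ≤ ∑ b ∈ range 8, |f s a b| :=
            single_le_sum (f := fun b => |f s a b|) (fun b _ => abs_nonneg _)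
              (mem_range.2 h.2)
        _ ≤ ∑ a ∈ range 8, ∑ b ∈ range 8, |f s a b| :=
            single_le_sum (f := fun a => ∑ b ∈ range 8, |f s a b|)
              (fun a _ => sum_nonneg fun b _ => abs_nonneg _) (mem_range.2 h.1)
        _ ≤ _ := single_le_sum (f := fun s => ∑ a ∈ range 8, ∑ b ∈ range 8, |f s a b|)
              (fun s _ => hnn s) (mem_univ s)
    · simp only [f', if_neg h, abs_zero]
      exact sum_nonneg fun s _ => hnn s
  let A : ℤ := 6 * |W| + 1
  have hA : 6 * W ≤ A := by
    have := le_abs_self W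
    simp only [A]
    linarith
  have hA0 : 0 < A := by
    have := abs_nonneg W
    simp only [A]
    linarith
  let M : ℤ := ∑ e, |P.cost A f' e|
  have hM : ∀ e, |P.cost A f' e| ≤ M := fun e =>
    single_le_sum (f := fun e => |P.cost A f' e|) (fun e _ => abs_nonneg _) (mem_univ e)
  let I := P.tspInstance φ A (3 * M) f'
  have hlt : ∀ {T T' : Finset (Sym2 (Vert Tok S))}, TSPInstance.IsTour T →
      TSPInstance.IsTour T' → (I.weight T < I.weight T' ↔
      ∑ e ∈ T, P.cost A f' e < ∑ e ∈ T', P.cost A f' e) := fun hT hT' =>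
    P.weight_tspInstance_lt_iff hφ A (3 * M) f' hT hT'
  have hsum := fun σ => P.sum_tour_eq σ A f'
  refine ⟨I, P.isMetric_tspInstance hφ hM le_rfl, ?_, ⟨P.tour σ₀, P.isTour_tour σ₀⟩, ?_⟩
  · change Fintype.card (Vert Tok S) = _
    simp
  rintro l x ⟨hx0, hx, hopt⟩
  have main : ∀ i ≤ l, ∃ σ, Inv σ ∧ (x i).1 = P.tour σ ∧ P.energy f σ₀ - i ≤ P.energy f σ := by
    intro i
    induction i with
    | zero => exact fun _ => ⟨σ₀, h₀, by rw [hx0], by simp⟩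
    | succ i ih =>
      intro hi
      obtain ⟨σ, hσ, hxi, hE⟩ := ih (by omega)
      obtain ⟨⟨⟨E₁, E₂, hswap, -, hx'⟩, -⟩, himp⟩ := hx i (by omega)
      change I.weight (x (i + 1)).1 < I.weight (x i).1 at himp
      rw [hlt (x (i + 1)).2 (x i).2, hxi] at himp
      rw [hxi] at hx'
      obtain ⟨τ, hτ⟩ := exists_eq_tour_update hA hA0 hW (x (i + 1)).2 hswap hx' himp
      rw [hτ, hsum, hsum, hen, hen, add_lt_add_iff_left] at himp
      obtain ⟨h1, h2⟩ := hstep σ τ hσ himp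
      refine ⟨_, h1, hτ, ?_⟩
      push_cast
      linarith
  obtain ⟨σ, hσ, hxl, hE⟩ := main l le_rfl
  have := hstuck σ hσ fun τ => by
    by_contra! hcon
    obtain ⟨E₁, E₂, hswap, hsub, hx'⟩ := P.exists_swap_update σ τ
    have h1 : I.weight (P.tour (Function.update σ τ (!σ τ))) < I.weight (x l).1 := by
      rw [hlt (P.isTour_tour _) (x l).2, hxl, hsum, hsum, hen, hen, add_lt_add_iff_left]
      exact hcon
    have h2 := hopt ⟨P.tour (Function.update σ τ (!σ τ)), P.isTour_tour _⟩
      ⟨⟨E₁, E₂, hswap, by rw [hxl]; exact hsub, by rw [hxl]; exact hx'⟩, h1⟩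
    exact absurd h1 (not_lt.2 h2)
  linarith

end Instance

end SlotSystem

/-! ### The layout of the rings -/

namespace RingTower

/-- The holes of a ring whose slots lie on the ring below. -/
def isOwn (h : Fin 21) : Bool :=
  !(h == 0 || h == 1 || h == 2 || h == 7 || h == 8 || h == 13 || h == 14)

/-- The index of the slot of a hole. -/
def slotIdx (h : Fin 21) : Fin 21 :=
  -- The seven holes that are not own go to seven different own slots of the ring below. A slot thus
  -- carries at most two holes, the own one at positions 3 and 4, the other at 1 and 2 or at 5 and
  -- 6.
  if h = 0 then 9 else if h = 1 then 18 else if h = 2 then 5 else if h = 7 then 4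
  else if h = 8 then 16 else if h = 13 then 17 else if h = 14 then 11 else h

/-- The position of the token `h` in the slot of the hole `h`; the token `h + 1` takes the next
position there. -/
def basePos (h : Fin 21) : ℕ := bif isOwn h then 3 else bif h == 0 || h == 13 then 5 else 1

/-- The level of the slot of a hole, relative to the level of the ring. -/
def lev (h : Fin 21) : ℕ := bif isOwn h then 1 else 0

/-- The hole next to the token `j`, on the side given by `b`. -/
def hole (j : Fin 21) (b : Bool) : Fin 21 := bif b then j else j - 1

/-- The position of the token `j` on the side given by `b`. -/
def tokPos (j : Fin 21) (b : Bool) : ℕ := basePos (hole j b) + bif b then 0 else 1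

variable {n : ℕ}

/-- The slot of a hole of a ring. -/
def site (x : Fin (n + 1) × Fin 21) : Fin (n + 2) × Fin 21 :=
  (bif isOwn x.2 then x.1.succ else x.1.castSucc, slotIdx x.2)

theorem site_eq_iff {i i' : Fin (n + 1)} {h h' : Fin 21} : site (i, h) = site (i', h') ↔
    i.val + lev h = i'.val + lev h' ∧ slotIdx h = slotIdx h' := by
  simp only [site, lev, Prod.mk.injEq, Fin.ext_iff]
  cases isOwn h <;> cases isOwn h' <;> simp

theorem tokPos_bounds : ∀ j b, 1 ≤ tokPos j b ∧ tokPos j b ≤ 6 := by decide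

theorem tok_inj : ∀ j b j' c, slotIdx (hole j b) = slotIdx (hole j' c) → tokPos j b = tokPos j' c →
    j = j' ∧ b = c := by decide +kernel

theorem hole_ne : ∀ j b c, slotIdx (hole j b) = slotIdx (hole j c) →
    lev (hole j b) = lev (hole j c) → b = c := by decide +kernel

/-- Along a closed walk the ring numbers cancel and only relative levels remain, so the whole tower
is covered by a finite check. The walks that survive go back along the same token. -/
theorem no_two_cycle : ∀ j b j' c, slotIdx (hole j (!b)) = slotIdx (hole j' c) →
    slotIdx (hole j' (!c)) = slotIdx (hole j b) →
    lev (hole j (!b)) + lev (hole j' (!c)) = lev (hole j' c) + lev (hole j b) →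
    j = j' ∧ c = !b := by decide +kernel

theorem no_three_cycle : ∀ j b j' c, slotIdx (hole j (!b)) = slotIdx (hole j' c) →
    ∀ j'' d, slotIdx (hole j' (!c)) = slotIdx (hole j'' d) →
    slotIdx (hole j'' (!d)) = slotIdx (hole j b) →
    lev (hole j (!b)) + lev (hole j' (!c)) + lev (hole j'' (!d)) ≠
      lev (hole j' c) + lev (hole j'' d) + lev (hole j b) := by decide +kernel

theorem no_four_cycle : ∀ j b j' c, slotIdx (hole j (!b)) = slotIdx (hole j' c) →
    ∀ j'' d, slotIdx (hole j' (!c)) = slotIdx (hole j'' d) →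
    ∀ j₃ e, slotIdx (hole j'' (!d)) = slotIdx (hole j₃ e) →
    slotIdx (hole j₃ (!e)) = slotIdx (hole j b) →
    lev (hole j (!b)) + lev (hole j' (!c)) + lev (hole j'' (!d)) + lev (hole j₃ (!e)) =
      lev (hole j' c) + lev (hole j'' d) + lev (hole j₃ e) + lev (hole j b) →
    (j = j' ∧ c = !b) ∨ (j' = j'' ∧ d = !c) := by decide +kernel

variable (n) in
/-- The slots of `n + 1` rings of 21 tokens each. Some holes of a ring are in the slots of the
ring below. -/
def slotSystem : SlotSystem (Fin (n + 1) × Fin 21) (Fin (n + 2) × Fin 21) where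
  place x b := site (x.1, hole x.2 b)
  pos x b := tokPos x.2 b
  one_le_pos x b := (tokPos_bounds x.2 b).1
  pos_le x b := (tokPos_bounds x.2 b).2
  inj x b y c h h' := by
    obtain ⟨i, j⟩ := x
    obtain ⟨i', j'⟩ := y
    rw [site_eq_iff] at h
    obtain ⟨rfl, rfl⟩ := tok_inj j b j' c h.2 h'
    exact ⟨Prod.ext (Fin.ext (by simpa using h.1)) rfl, rfl⟩
  place_ne x b c h := by
    rw [site_eq_iff] at h
    exact hole_ne x.2 b c h.2 (by simpa using h.1)
  no_two_cycle x b y c hxy h h' := by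
    rw [site_eq_iff] at h h'
    obtain ⟨h1, rfl⟩ := no_two_cycle x.2 b y.2 c h.2 h'.2 (by omega)
    refine hxy (Prod.ext (Fin.ext ?_) h1)
    rw [h1] at h
    simpa using h.1
  no_three_cycle x b y c z d h h' h'' := by
    rw [site_eq_iff] at h h' h''
    exact no_three_cycle x.2 b y.2 c h.2 z.2 d h'.2 h''.2 (by omega)
  no_four_cycle x b y c z d t e hn h h' h'' h₃ := by
    rw [site_eq_iff] at h h' h'' h₃
    simp only [List.nodup_cons, List.mem_cons, not_or] at hn
    rcases no_four_cycle x.2 b y.2 c h.2 z.2 d h'.2 t.2 e h''.2 h₃.2 (by omega) with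
      ⟨h1, rfl⟩ | ⟨h1, rfl⟩
    · refine hn.1.1 (Prod.ext (Fin.ext ?_) h1)
      rw [h1] at h
      simpa using h.1
    · refine hn.2.1.1 (Prod.ext (Fin.ext ?_) h1)
      rw [h1] at h'
      simpa using h'.1
  num := (n + 2) * 21 - 2
  enum := finProdFinEquiv.trans (finCongr (by omega))

end RingTower

theorem sum_consecutivePos_single (o : Fin 8 → Bool) (a₀ b₀ : Fin 8) :
    (∑ a, ∑ b, if ConsecutivePos o a b then (if a.val = a₀.val ∧ b.val = b₀.val then 1 else 0)
      else (0 : ℤ)) = if ConsecutivePos o a₀ b₀ then 1 else 0 := by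
  rw [sum_eq_single a₀, sum_eq_single b₀]
  · simp
  · intro b _ hb
    have : ¬ b.val = b₀.val := fun h => hb (Fin.ext h)
    simp [this]
  · simp
  · intro a _ ha
    have : ¬ a.val = a₀.val := fun h => ha (Fin.ext h)
    simp [this]
  · simp

/-- A filled position other than 0 is the right end of exactly one edge, so a weight on right ends
acts as a field on one token. -/
theorem sum_consecutivePos_right : ∀ o : Fin 8 → Bool, o 0 = true → o 7 = true → ∀ q : Fin 8,
    0 < q → (∑ a, ∑ b, if ConsecutivePos o a b then (if b.val = q.val then 1 else 0) else (0 : ℤ)) =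
      bif o q then 1 else 0 := by
  decide +kernel

theorem SlotSystem.filled_place {Tok S : Type} {P : SlotSystem Tok S} {σ : Tok → Bool} {x : Tok}
    {b : Bool} {a : Fin 8} (ha : a.val = P.pos x b) :
    P.filled σ (P.place x b) a = true ↔ σ x = b := by
  rw [filled_eq_true]
  constructor
  · rintro ⟨v, hv⟩
    have : v = .inl x := hv.sits.vert_unique ⟨b, rfl, ha.symm⟩
    subst this
    exact P.place_ne _ _ _ hv.1
  · rintro rfl
    exact ⟨.inl x, rfl, ha.symm⟩

/-! ### Fields, walls and couplings realized by slot weights -/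

namespace RingTower

/-- The indicator of a Boolean. -/
def ind (b : Bool) : ℤ := bif b then 1 else 0

/-- The contribution of the hole `h` of a ring to the weights in its slot: a field `F` on the token
`h`, a price `D` for both tokens `h` and `h + 1` in the slot, and a coupling `J` with the ring
below when there is none. -/
def edgeWeight (F D J K : ℤ) (h : Fin 21) (a b : ℕ) : ℤ :=
  F * (if b = basePos h then 1 else 0) +
    (D + K * ind (h != 20)) * (if a = basePos h ∧ b = basePos h + 1 then 1 else 0) +
    -- These edges join a backbone vertex to a token of the ring below across two empty positions,
    -- namely those of the tokens `h` and `h + 1`.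
    J * (if basePos h = 5 then (if a = 4 ∧ b = 7 then 1 else 0)
      else (if a = 0 ∧ b = 3 then 1 else 0)) -
    -- An empty slot of hole 20 refunds the price of one wall.
    K * ind (h == 20) * (if a = 0 ∧ b = 7 then 1 else 0)

variable {n : ℕ}

/-- The weights in the slots. -/
def slotWeight (F D J : ℕ → Fin 21 → ℤ) (K : ℤ) (s : Fin (n + 2) × Fin 21) (a b : ℕ) : ℤ :=
  ∑ x : Fin (n + 1) × Fin 21, if site x = s then
    edgeWeight (F x.1 x.2) (D x.1 x.2) (J x.1 x.2) K x.2 a b else 0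

theorem energy_slotWeight (F D J : ℕ → Fin 21 → ℤ) (K : ℤ) (σ : Fin (n + 1) × Fin 21 → Bool) :
    (slotSystem n).energy (slotWeight F D J K) σ = ∑ x : Fin (n + 1) × Fin 21,
      ∑ a : Fin 8, ∑ b : Fin 8, if ConsecutivePos ((slotSystem n).filled σ (site x)) a b then
        edgeWeight (F x.1 x.2) (D x.1 x.2) (J x.1 x.2) K x.2 a b else 0 := by
  have h1 : ∀ (s : Fin (n + 2) × Fin 21) (a b : Fin 8),
      (if ConsecutivePos ((slotSystem n).filled σ s) a b then slotWeight F D J K s a b else 0) =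
      ∑ x : Fin (n + 1) × Fin 21, if site x = s then
        (if ConsecutivePos ((slotSystem n).filled σ s) a b then
          edgeWeight (F x.1 x.2) (D x.1 x.2) (J x.1 x.2) K x.2 a b else 0) else 0 := by
    intro s a b
    split_ifs with h
    · rfl
    · simp
  unfold SlotSystem.energy
  simp_rw [h1]
  rw [sum_congr rfl fun s _ => sum_congr rfl fun a _ => sum_comm]
  rw [sum_congr rfl fun s _ => sum_comm, sum_comm]
  refine sum_congr rfl fun x _ => ?_
  rw [sum_eq_single (site x)]
  · simp
  · intro s _ hs
    simp [hs.symm]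
  · simp

theorem filled_site (σ : Fin (n + 1) × Fin 21 → Bool) (i : Fin (n + 1)) (h : Fin 21) {a : Fin 8}
    (ha : a.val = basePos h) : (slotSystem n).filled σ (site (i, h)) a = σ (i, h) := by
  rw [Bool.eq_iff_iff]
  exact SlotSystem.filled_place (P := slotSystem n) (x := (i, h)) (b := true) ha

theorem filled_site_succ (σ : Fin (n + 1) × Fin 21 → Bool) (i : Fin (n + 1)) (h : Fin 21)
    {a : Fin 8} (ha : a.val = basePos h + 1) :
    (slotSystem n).filled σ (site (i, h)) a = !σ (i, h + 1) := by
  have h1 : hole (h + 1) false = h := by simp [hole]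
  have h2 : (slotSystem n).place (i, h + 1) false = site (i, h) := by
    change site (i, hole (h + 1) false) = _
    rw [h1]
  have h3 : a.val = (slotSystem n).pos (i, h + 1) false := by
    change _ = basePos (hole (h + 1) false) + 1
    rw [h1, ha]
  have h4 := SlotSystem.filled_place (σ := σ) h3
  rw [h2] at h4
  rw [Bool.eq_iff_iff, h4]
  simp

/-- The token of the ring below that enters the coupling of a hole. -/
def lower (h : Fin 21) (β : Fin 21 → Bool) : Bool :=
  bif basePos h == 5 then !β (slotIdx h + 1) else β (slotIdx h)

theorem slotIdx_own : ∀ h, isOwn h = false → isOwn (slotIdx h) = true ∧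
    slotIdx (slotIdx h) = slotIdx h := by decide

theorem site_slotIdx {i : Fin n} {h : Fin 21} (hh : isOwn h = false) :
    (site (i.succ, h) : Fin (n + 2) × Fin 21) = site (i.castSucc, slotIdx h) := by
  obtain ⟨h1, h2⟩ := slotIdx_own h hh
  simp [site, hh, h1, h2]

theorem filled_lower (σ : Fin (n + 1) × Fin 21 → Bool) {i : Fin n} {h : Fin 21}
    (hh : isOwn h = false) :
    (bif basePos h == 5 then (slotSystem n).filled σ (site (i.succ, h)) 4
      else (slotSystem n).filled σ (site (i.succ, h)) 3) =
      lower h fun j => σ (i.castSucc, j) := by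
  have h3 : basePos (slotIdx h) = 3 := by simp [basePos, (slotIdx_own h hh).1]
  rw [site_slotIdx hh, filled_site_succ (a := 4) _ _ _ (by rw [h3]; rfl),
    filled_site (a := 3) _ _ _ (by rw [h3]; rfl)]
  rfl

theorem tokPos_of_slotIdx_eq : ∀ j b, slotIdx (hole j b) = 20 →
    tokPos j b = 3 ∨ tokPos j b = 4 := by decide

/-- No hole of the ring above uses this slot, so it is empty as soon as its own two tokens are away.
-/
theorem filled_twenty (σ : Fin (n + 1) × Fin 21 → Bool) (i : Fin (n + 1)) {a : Fin 8}
    (h0 : a ≠ 0) (h3 : a ≠ 3) (h4 : a ≠ 4) (h7 : a ≠ 7) :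
    (slotSystem n).filled σ (site (i, 20)) a = false := by
  rw [Bool.eq_false_iff, Ne, SlotSystem.filled_eq_true]
  rintro ⟨v, hv⟩
  rcases v with x | ⟨t, b⟩
  · obtain ⟨h1, h2⟩ := hv
    have h5 : slotIdx (hole x.2 (σ x)) = 20 := by
      have := congrArg Prod.snd h1
      simpa [slotSystem, site, slotIdx] using this
    have h6 : tokPos x.2 (σ x) = a.val := h2
    rcases tokPos_of_slotIdx_eq _ _ h5 with h | h <;> rw [h] at h6
    · exact h3 (Fin.ext h6.symm)
    · exact h4 (Fin.ext h6.symm)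
  · obtain ⟨-, h2⟩ := hv
    cases b
    · exact h0 (Fin.ext h2.symm)
    · exact h7 (Fin.ext h2.symm)

theorem consecutivePos_zero_three : ∀ o : Fin 8 → Bool, o 0 = true → o 7 = true →
    (if ConsecutivePos o 0 3 then 1 else 0) = ind (!o 1 && !o 2 && o 3) := by decide +kernel

theorem consecutivePos_four_seven : ∀ o : Fin 8 → Bool, o 0 = true → o 7 = true →
    (if ConsecutivePos o 4 7 then 1 else 0) = ind (!o 5 && !o 6 && o 4) := by decide +kernel

theorem consecutivePos_zero_seven : ∀ o : Fin 8 → Bool, o 0 = true → o 7 = true →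
    (if ConsecutivePos o 0 7 then 1 else 0) =
      ind (!o 1 && !o 2 && !o 3 && !o 4 && !o 5 && !o 6) := by decide +kernel

theorem consecutivePos_succ : ∀ (o : Fin 8 → Bool) (a b : Fin 8), b.val = a.val + 1 →
    (if ConsecutivePos o a b then 1 else 0) = ind (o a && o b) := by decide +kernel

end RingTower

namespace RingTower

theorem sum_edgeWeight {o : Fin 8 → Bool} (h0 : o 0 = true) (h7 : o 7 = true) (F D J K : ℤ)
    {h : Fin 21} {q q' : Fin 8} (hq : q.val = basePos h) (hq' : q'.val = basePos h + 1) :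
    (∑ a : Fin 8, ∑ b : Fin 8, if ConsecutivePos o a b then edgeWeight F D J K h a b else 0) =
      F * ind (o q) + (D + K * ind (h != 20)) * ind (o q && o q') +
        J * ind (bif basePos h == 5 then !o 5 && !o 6 && o 4 else !o 1 && !o 2 && o 3) -
        K * ind (h == 20) * ind (!o 1 && !o 2 && !o 3 && !o 4 && !o 5 && !o 6) := by
  have h1 : ∀ a b : Fin 8, (if ConsecutivePos o a b then edgeWeight F D J K h a b else 0) =
      F * (if ConsecutivePos o a b then (if b.val = q.val then 1 else 0) else 0) +
      (D + K * ind (h != 20)) * (if ConsecutivePos o a b then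
        (if a.val = q.val ∧ b.val = q'.val then 1 else 0) else 0) +
      J * (if ConsecutivePos o a b then
        (if basePos h = 5 then (if a.val = (4 : Fin 8).val ∧ b.val = (7 : Fin 8).val then 1 else 0)
        else (if a.val = (0 : Fin 8).val ∧ b.val = (3 : Fin 8).val then 1 else 0)) else 0) -
      K * ind (h == 20) * (if ConsecutivePos o a b then
        (if a.val = (0 : Fin 8).val ∧ b.val = (7 : Fin 8).val then 1 else 0) else 0) := by
    intro a b
    by_cases hc : ConsecutivePos o a b
    · simp only [if_pos hc, hq, hq']
      rfl
    · simp only [if_neg hc, mul_zero, add_zero, sub_zero]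
  have hq0 : 0 < q := by
    rw [Fin.lt_def, hq]
    simp only [basePos]
    cases isOwn h <;> cases (h == 0 || h == 13) <;> simp
  simp_rw [h1, sum_sub_distrib, sum_add_distrib, ← mul_sum]
  rw [sum_consecutivePos_right o h0 h7 q hq0, sum_consecutivePos_single,
    sum_consecutivePos_single, consecutivePos_succ o q q' (by rw [hq', hq]),
    consecutivePos_zero_seven o h0 h7]
  by_cases h5 : basePos h = 5
  · simp only [if_pos h5]
    rw [sum_consecutivePos_single, consecutivePos_four_seven o h0 h7]
    simp [h5, ind]
  · simp only [if_neg h5]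
    rw [sum_consecutivePos_single, consecutivePos_zero_three o h0 h7, beq_false_of_ne h5]
    simp [ind]

variable {n : ℕ}

/-- The energy of a ring: fields `F` and prices `D` of domain walls. -/
def ringEnergy (F D : Fin 21 → ℤ) (β : Fin 21 → Bool) : ℤ :=
  ∑ h, (F h * ind (β h) + D h * ind (β h && !β (h + 1)))

/-- The number of surplus domain walls of a ring. -/
def wallExcess (β : Fin 21 → Bool) : ℤ :=
  ∑ h, (ind (h != 20) * ind (β h && !β (h + 1)) - ind (h == 20) * ind (!β 20 && β 0))

/-- The coupling of a ring `β` with the ring `γ` below. -/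
def couplingEnergy (J : Fin 21 → ℤ) (β γ : Fin 21 → Bool) : ℤ :=
  ∑ h, J h * ind (!β h && β (h + 1) && lower h γ)

theorem exists_base_fin : ∀ h, ∃ q q' : Fin 8, q.val = basePos h ∧ q'.val = basePos h + 1 := by
  decide

theorem basePos_cases (h : Fin 21) : isOwn h = true ∧ basePos h = 3 ∨
    isOwn h = false ∧ basePos h = 5 ∨ isOwn h = false ∧ basePos h = 1 := by
  revert h
  decide

/-- A coupling is only meaningful in a slot shared with the ring below, hence the alternative in
`hJ`. -/
theorem sum_site (F D J : ℕ → Fin 21 → ℤ) (K : ℤ) (σ : Fin (n + 1) × Fin 21 → Bool)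
    (i : Fin (n + 1)) (h : Fin 21) (γ : Fin 21 → Bool)
    (hJ : J i h = 0 ∨ isOwn h = false ∧ ∃ k : Fin n, i = k.succ ∧ γ = fun j => σ (k.castSucc, j)) :
    (∑ a : Fin 8, ∑ b : Fin 8, if ConsecutivePos ((slotSystem n).filled σ (site (i, h))) a b then
        edgeWeight (F i h) (D i h) (J i h) K h a b else 0) =
      (F i h * ind (σ (i, h)) + D i h * ind (σ (i, h) && !σ (i, h + 1))) +
      K * (ind (h != 20) * ind (σ (i, h) && !σ (i, h + 1)) -
        ind (h == 20) * ind (!σ (i, 20) && σ (i, 0))) +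
      J i h * ind (!σ (i, h) && σ (i, h + 1) && lower h γ) := by
  obtain ⟨q, q', hq, hq'⟩ := exists_base_fin h
  rw [sum_edgeWeight SlotSystem.filled_zero SlotSystem.filled_seven _ _ _ _ hq hq',
    filled_site σ i h hq, filled_site_succ σ i h hq']
  have hJ' : J i h * ind (bif basePos h == 5 then
        !(slotSystem n).filled σ (site (i, h)) 5 && !(slotSystem n).filled σ (site (i, h)) 6 &&
          (slotSystem n).filled σ (site (i, h)) 4
      else !(slotSystem n).filled σ (site (i, h)) 1 && !(slotSystem n).filled σ (site (i, h)) 2 &&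
          (slotSystem n).filled σ (site (i, h)) 3) =
      J i h * ind (!σ (i, h) && σ (i, h + 1) && lower h γ) := by
    rcases hJ with hJ | ⟨hh, k, rfl, rfl⟩
    · rw [hJ, zero_mul, zero_mul]
    · rw [← filled_lower σ hh]
      rcases basePos_cases h with ⟨h1, h2⟩ | ⟨h1, h2⟩ | ⟨h1, h2⟩
      · rw [hh] at h1
        exact Bool.noConfusion h1
      · rw [filled_site (a := 5) _ _ _ (by rw [h2]; rfl),
          filled_site_succ (a := 6) _ _ _ (by rw [h2]; rfl)]
        simp [h2]
      · rw [filled_site (a := 1) _ _ _ (by rw [h2]; rfl),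
          filled_site_succ (a := 2) _ _ _ (by rw [h2]; rfl)]
        simp [h2]
  have hK : ind (h == 20) * ind (!(slotSystem n).filled σ (site (i, h)) 1 &&
        !(slotSystem n).filled σ (site (i, h)) 2 && !(slotSystem n).filled σ (site (i, h)) 3 &&
        !(slotSystem n).filled σ (site (i, h)) 4 && !(slotSystem n).filled σ (site (i, h)) 5 &&
        !(slotSystem n).filled σ (site (i, h)) 6) =
      ind (h == 20) * ind (!σ (i, 20) && σ (i, 0)) := by
    by_cases hh : h = 20
    · subst hh
      rw [filled_twenty (a := 1) _ _ (by decide) (by decide) (by decide) (by decide),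
        filled_twenty (a := 2) _ _ (by decide) (by decide) (by decide) (by decide),
        filled_twenty (a := 5) _ _ (by decide) (by decide) (by decide) (by decide),
        filled_twenty (a := 6) _ _ (by decide) (by decide) (by decide) (by decide),
        filled_site (a := 3) _ _ _ rfl, filled_site_succ (a := 4) _ _ _ rfl]
      simp
    · rw [beq_false_of_ne hh]
      simp [ind]
  rw [hJ', mul_assoc, hK]
  ring

theorem energy_eq (F D J : ℕ → Fin 21 → ℤ) (K : ℤ) (hJ₀ : ∀ h, J 0 h = 0)
    (hJ : ∀ i h, isOwn h = true → J i h = 0) (σ : Fin (n + 1) × Fin 21 → Bool) :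
    (slotSystem n).energy (slotWeight F D J K) σ =
      (∑ i : Fin (n + 1), ringEnergy (F i) (D i) fun j => σ (i, j)) +
      K * (∑ i : Fin (n + 1), wallExcess fun j => σ (i, j)) +
      ∑ k : Fin n, couplingEnergy (J (k + 1)) (fun j => σ (k.succ, j))
        fun j => σ (k.castSucc, j) := by
  let γ : Fin (n + 1) → Fin 21 → Bool :=
    Fin.cases (fun _ => false) fun k j => σ (k.castSucc, j)
  rw [energy_slotWeight, Fintype.sum_prod_type]
  have h1 : ∀ (i : Fin (n + 1)) (h : Fin 21), _ := fun i h =>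
    sum_site F D J K σ i h (γ i) <| by
      by_cases hh : isOwn h = true
      · exact Or.inl (hJ _ _ hh)
      · induction i using Fin.cases with
        | zero => exact Or.inl (hJ₀ h)
        | succ k => exact Or.inr ⟨by simpa using hh, k, rfl, rfl⟩
  simp_rw [h1, sum_add_distrib, ← mul_sum, Fin.sum_univ_succ (f := fun i : Fin (n + 1) =>
    ∑ h, J i h * ind (!σ (i, h) && σ (i, h + 1) && lower h (γ i)))]
  simp only [Fin.val_zero, hJ₀, zero_mul, sum_const_zero, zero_add, Fin.val_succ]
  simp only [ringEnergy, sum_add_distrib]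
  rfl

end RingTower

/-! ### The 42 states of a ring and the finite checks -/

namespace RingTower

/-- The states that a ring runs through: going from `t` to `t + 1` flips one token. -/
def ring (t : Fin 42) (j : Fin 21) : Bool := decide (j.val < t.val ∧ t.val ≤ j.val + 21)

/-- The number of steps since state `19`. -/
def phase (t : Fin 42) : ℕ := (t.val + 23) % 42

/-- The states with a raised energy. -/
def bump (t : Fin 42) : ℤ := if t.val = 29 ∨ t.val = 30 then 1 else 0

/-- The number of descents passed by a state. -/
def descents (t : Fin 42) : ℤ :=
  (if 5 ≤ phase t then 1 else 0) + (if 16 ≤ phase t then 1 else 0)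

/-- The fields that produce given energies of the states. -/
def fieldOf (e : Fin 42 → ℤ) (h : Fin 21) : ℤ :=
  -- Leaving state `21 + h` switches token `h` off, and no priced wall is present before or after.
  e ⟨21 + h.val, by omega⟩ - e (⟨21 + h.val, by omega⟩ + 1)

/-- The wall prices that produce given energies of the states. -/
def wallOf (e : Fin 42 → ℤ) (h : Fin 21) : ℤ :=
  -- In state `h + 1` exactly the tokens up to `h` are on, and the only priced wall is at `h`.
  if h = 20 then 0 else e ⟨h.val + 1, by omega⟩ - e 0 - ∑ l, if l ≤ h then fieldOf e l else 0

/-- Ring energies are linear in fields and wall prices, so three profiles, checked state by state,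
suffice for all heights. -/
theorem ringEnergy_phase : ∀ t, ringEnergy (fieldOf fun t => (phase t : ℤ))
    (wallOf fun t => (phase t : ℤ)) (ring t) = phase t - phase 0 := by
  decide +kernel

theorem ringEnergy_bump : ∀ t, ringEnergy (fieldOf bump) (wallOf bump) (ring t) =
    bump t - bump 0 := by
  decide +kernel

theorem ringEnergy_descents : ∀ t, ringEnergy (fieldOf descents) (wallOf descents) (ring t) =
    descents t - descents 0 := by
  decide +kernel

theorem wallExcess_ring : ∀ t, wallExcess (ring t) = 0 := by
  decide +kernel

/-- Any flip other than a step forwards or backwards creates a surplus wall. -/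
theorem ring_succ : ∀ t j, Function.update (ring t) j (!ring t j) = ring (t + 1) ∨
    Function.update (ring t) j (!ring t j) = ring (t - 1) ∨
    1 ≤ wallExcess (Function.update (ring t) j (!ring t j)) := by
  decide +kernel

theorem exists_flip_ring : ∀ t, ∃ j, Function.update (ring t) j (!ring t j) = ring (t + 1) := by
  decide +kernel

/-- The constant part of the coupling. -/
def couplingConst (h : Fin 21) : ℤ :=
  -- A constant 2 exceeds the unit gain of a step and so blocks it. The entries -2 pay for `bump`,
  -- which otherwise holds the ring back until the ring below has advanced.
  if h = 0 ∨ h = 2 ∨ h = 14 then 2 else if h = 7 ∨ h = 8 then -2 else 0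

/-- The part of the coupling that is proportional to the height. -/
def couplingSlope (h : Fin 21) : ℤ :=
  -- At the holes 1 and 13, switching on token 18 of the ring below gains the full height of the
  -- upper ring; this flip is its barrier step from 18 to 19.
  if h = 2 ∨ h = 13 ∨ h = 14 then 1 else if h = 1 then -1 else 0

/-- The coupling of the states of two consecutive rings. -/
def coupling (J : Fin 21 → ℤ) (u b : Fin 42) : ℤ :=
  if h : 22 ≤ u.val then J ⟨u.val - 22, by omega⟩ * ind (lower ⟨u.val - 22, by omega⟩ (ring b))
  else 0

/-- A coupling at hole `h` is felt in a single state of the upper ring. -/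
theorem hole_ring : ∀ u h, h ≠ 20 → (!ring u h && ring u (h + 1)) = decide (u.val = 22 + h.val) := by
  decide +kernel

theorem couplingEnergy_ring {J : Fin 21 → ℤ} (hJ : J 20 = 0) (u b : Fin 42) :
    couplingEnergy J (ring u) (ring b) = coupling J u b := by
  have h1 : ∀ h, J h * ind (!ring u h && ring u (h + 1) && lower h (ring b)) =
      J h * ind (decide (u.val = 22 + h.val) && lower h (ring b)) := by
    intro h
    by_cases hh : h = 20
    · rw [hh, hJ, zero_mul, zero_mul]
    · rw [hole_ring u h hh]
  simp only [couplingEnergy, h1]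
  unfold coupling
  split_ifs with h
  · rw [sum_eq_single ⟨u.val - 22, by omega⟩]
    · have : u.val = 22 + (u.val - 22) := by omega
      simp [← this]
    · intro k _ hk
      have : ¬ u.val = 22 + k.val := fun h' => hk (Fin.ext (by simp [h']))
      simp [this, ind]
    · simp
  · refine sum_eq_zero fun k _ => ?_
    have : ¬ u.val = 22 + k.val := by omega
    simp [this, ind]

/-- The pairs of states of consecutive rings that occur. -/
def compat (u b : Fin 42) : Bool :=
  let p := phase u
  let q := phase b
  -- Lower bounds on `q` record how far the ring below had to advance before the upper ring could
  -- proceed. The upper bounds 20, 28 and 34 are where a coupling stops it until the upper ring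
  -- moves on; the ranges that wrap around, at phases 4 and 16, contain its barrier crossings.
  if p = 3 then 34 ≤ q
  else if p = 4 then q ≤ 20 || 34 ≤ q
  else if p = 5 then 8 ≤ q && q ≤ 28
  else if 6 ≤ p && p ≤ 9 then 8 ≤ q
  else if p = 10 then 28 ≤ q
  else if 11 ≤ p && p ≤ 15 then 40 ≤ q
  else if p = 16 then q ≤ 20 || 40 ≤ q
  else if p = 17 then 14 ≤ q && q ≤ 34
  else 14 ≤ q

/-- The steps that change the coupling with the ring below. -/
def touchesLower (t : Fin 42) : Bool :=
  t ∈ ([21, 22, 23, 24, 28, 29, 30, 34, 35, 36] : List (Fin 42))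

/-- The steps that change the coupling with the ring above. -/
def touchesUpper (t : Fin 42) : Bool :=
  t ∈ ([4, 5, 10, 11, 16, 18, 25, 26, 31, 32, 37, 39] : List (Fin 42))

/-- The change of the energy of a ring by the step from `t`, as the coefficients of an affine
function of the height. -/
def ownStep (κ : Bool) (t : Fin 42) : ℤ × ℤ :=
  (-((phase (t + 1) : ℤ) - phase t) + 2 * ind κ * (bump (t + 1) - bump t),
    -(ind κ * (descents (t + 1) - descents t)))

/-- The change of the coupling with the ring below. -/
def lowerStep (t b : Fin 42) : ℤ × ℤ :=
  (coupling couplingConst (t + 1) b - coupling couplingConst t b,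
    coupling couplingSlope (t + 1) b - coupling couplingSlope t b)

/-- The change of the coupling with the ring above, whose height is twice the height of this ring
plus 42; a ring of height zero has `κ = false`. -/
def upperStep (κ : Bool) (u t : Fin 42) : ℤ × ℤ :=
  (coupling couplingConst u (t + 1) - coupling couplingConst u t +
      42 * (coupling couplingSlope u (t + 1) - coupling couplingSlope u t),
    ind κ * 2 * (coupling couplingSlope u (t + 1) - coupling couplingSlope u t))

theorem lowerStep_eq_zero : ∀ t b, touchesLower t = false → lowerStep t b = 0 := by
  decide +kernel

theorem upperStep_eq_zero : ∀ κ u t, touchesUpper t = false → upperStep κ u t = 0 := by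
  decide +kernel

/-- No step feels both neighboring rings, so checking pairs of adjacent rings is enough. -/
theorem touchesUpper_eq_false : ∀ t, touchesLower t = true → touchesUpper t = false := by
  decide +kernel

/-- Apart from the barrier, bumps and descents occur only at steps that feel the ring below. -/
theorem ownStep_cases : ∀ κ t, (touchesLower t = true → κ = false) →
    (t ≠ 18 → (ownStep κ t).1 = -1 ∧ (κ = true → (ownStep κ t).2 = 0)) ∧
      (t = 18 → 0 ≤ (ownStep κ t).1 ∧ 0 ≤ (ownStep κ t).2) := by
  decide +kernel

/-- The comparison is made coefficient by coefficient, so it holds at every nonnegative height. -/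
theorem lower_cases : ∀ t b, touchesUpper t = false → compat t b = true →
    (ownStep true t + lowerStep t b = (-1, 0) ∧ compat (t + 1) b = true) ∨
      0 ≤ ownStep true t + lowerStep t b := by
  decide +kernel

theorem compat_of_touchesUpper : ∀ t b, touchesUpper t = true → compat t b = true →
    compat (t + 1) b = true := by
  decide +kernel

theorem upper_cases : ∀ κ u t, touchesUpper t = true → compat u t = true →
    (ownStep κ t + upperStep κ u t = (-1, 0) ∧ compat u (t + 1) = true) ∨
      0 ≤ ownStep κ t + upperStep κ u t := by
  decide +kernel

theorem compat_of_touchesUpper_eq_false : ∀ u t, touchesUpper t = false → compat u t = true →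
    compat u (t + 1) = true := by
  decide +kernel

/-- Compatibility is assumed only after the step, because this is where a backward step starts. -/
theorem lower_back : ∀ t b, touchesUpper t = false → compat (t + 1) b = true →
    ownStep true t + lowerStep t b ≤ 0 := by
  decide +kernel

theorem upper_back : ∀ κ u t, touchesUpper t = true → compat u (t + 1) = true →
    ownStep κ t + upperStep κ u t ≤ 0 := by
  decide +kernel

/-- No deadlock: a ring waits for the ring below only while the latter can still move or itself
waits for a lower one. -/
theorem not_lower_stuck : ∀ κ u b, touchesLower b = false → compat u b = true →
    0 ≤ ownStep κ b + upperStep κ u b → touchesLower u = true →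
    ¬ 0 ≤ ownStep true u + lowerStep u b := by
  decide +kernel

/-- A ring in state 18 exerts no coupling, so beneath it only the barrier can stop a ring that does
not wait for a lower one. -/
theorem eq_of_upper_stuck : ∀ κ b, touchesLower b = false → compat 18 b = true →
    0 ≤ ownStep κ b + upperStep κ 18 b → b = 18 := by
  decide +kernel

end RingTower

/-! ### Heights and the energy of the tower -/

namespace RingTower

/-- The height of the barriers of a ring. -/
def height (i : ℕ) : ℤ := 42 * (2 ^ i - 1)

/-- Whether a ring is above another one. -/
def upper (i : ℕ) : Bool := decide (0 < i)

theorem height_zero : height 0 = 0 := by simp [height]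

theorem height_succ (i : ℕ) : height (i + 1) = 2 * height i + 42 := by
  simp only [height, pow_succ]
  ring

theorem height_nonneg (i : ℕ) : 0 ≤ height i := by
  have : (1 : ℤ) ≤ 2 ^ i := one_le_pow₀ (by norm_num)
  simp only [height]
  linarith

theorem ind_upper_mul_height (i : ℕ) : ind (upper i) * height i = height i := by
  cases i with
  | zero => rw [height_zero, mul_zero]
  | succ i => simp [upper, ind]

/-- The value of an affine function of the height. -/
def atHeight (i : ℕ) (x : ℤ × ℤ) : ℤ := x.1 + x.2 * height i

theorem atHeight_add (i : ℕ) (x y : ℤ × ℤ) : atHeight i (x + y) = atHeight i x + atHeight i y := by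
  simp only [atHeight, Prod.fst_add, Prod.snd_add]
  ring

theorem atHeight_nonneg {x : ℤ × ℤ} (i : ℕ) (h : 0 ≤ x) : 0 ≤ atHeight i x :=
  add_nonneg h.1 (mul_nonneg h.2 (height_nonneg i))

theorem atHeight_nonpos {x : ℤ × ℤ} (i : ℕ) (h : x ≤ 0) : atHeight i x ≤ 0 :=
  add_nonpos h.1 (mul_nonpos_of_nonpos_of_nonneg h.2 (height_nonneg i))

/-- The energy of a state of a ring. -/
def stateEnergy (i : ℕ) (t : Fin 42) : ℤ :=
  -(phase t : ℤ) + 2 * ind (upper i) * bump t - height i * descents t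

/-- The fields of the rings. -/
def fields (i : ℕ) (h : Fin 21) : ℤ :=
  -fieldOf (fun t => (phase t : ℤ)) h + 2 * ind (upper i) * fieldOf bump h -
    height i * fieldOf descents h

/-- The wall prices of the rings. -/
def walls (i : ℕ) (h : Fin 21) : ℤ :=
  -wallOf (fun t => (phase t : ℤ)) h + 2 * ind (upper i) * wallOf bump h -
    height i * wallOf descents h

/-- The couplings of the rings. -/
def couplings (i : ℕ) (h : Fin 21) : ℤ :=
  ind (upper i) * (couplingConst h + couplingSlope h * height i)

theorem ringEnergy_ring (i : ℕ) (t : Fin 42) :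
    ringEnergy (fields i) (walls i) (ring t) = stateEnergy i t - stateEnergy i 0 := by
  have h : ringEnergy (fields i) (walls i) (ring t) =
      -ringEnergy (fieldOf fun t => (phase t : ℤ)) (wallOf fun t => (phase t : ℤ)) (ring t) +
      2 * ind (upper i) * ringEnergy (fieldOf bump) (wallOf bump) (ring t) -
      height i * ringEnergy (fieldOf descents) (wallOf descents) (ring t) := by
    simp only [ringEnergy, mul_sum, ← sum_neg_distrib, ← sum_add_distrib, ← sum_sub_distrib]
    refine sum_congr rfl fun h _ => ?_
    simp only [fields, walls]
    ring
  rw [h, ringEnergy_phase, ringEnergy_bump, ringEnergy_descents]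
  simp only [stateEnergy]
  ring

/-- The coupling of the states of the rings `k + 1` and `k`. -/
def stateCoupling (k : ℕ) (u b : Fin 42) : ℤ :=
  coupling couplingConst u b + height (k + 1) * coupling couplingSlope u b

theorem couplingEnergy_couplings (k : ℕ) (u b : Fin 42) :
    couplingEnergy (couplings (k + 1)) (ring u) (ring b) = stateCoupling k u b := by
  rw [couplingEnergy_ring (by simp [couplings, couplingConst, couplingSlope]), stateCoupling]
  unfold coupling
  split_ifs
  · simp only [couplings, upper, ind]
    simp
    ring
  · simp

variable {n : ℕ}

/-- The configuration with given states of the rings. -/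
def config (n : ℕ) (t : ℕ → Fin 42) (x : Fin (n + 1) × Fin 21) : Bool := ring (t x.1) x.2

/-- The energy of given states of the rings. -/
def totalEnergy (n : ℕ) (t : ℕ → Fin 42) : ℤ :=
  ∑ i ∈ range (n + 1), (stateEnergy i (t i) - stateEnergy i 0) +
    ∑ k ∈ range n, stateCoupling k (t (k + 1)) (t k)

/-- The energy of a configuration, except for surplus domain walls. -/
def baseEnergy (σ : Fin (n + 1) × Fin 21 → Bool) : ℤ :=
  (∑ i : Fin (n + 1), ringEnergy (fields i) (walls i) fun j => σ (i, j)) +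
    ∑ k : Fin n, couplingEnergy (couplings (k + 1)) (fun j => σ (k.succ, j))
      fun j => σ (k.castSucc, j)

theorem energy_eq_baseEnergy (K : ℤ) (σ : Fin (n + 1) × Fin 21 → Bool) :
    (slotSystem n).energy (slotWeight fields walls couplings K) σ =
      baseEnergy σ + K * ∑ i : Fin (n + 1), wallExcess fun j => σ (i, j) := by
  have hown : ∀ h, isOwn h = true → couplingConst h = 0 ∧ couplingSlope h = 0 := by decide
  rw [energy_eq, baseEnergy]
  · ring
  · intro h
    simp [couplings, upper, ind]
  · intro i h hh
    simp [couplings, hown h hh]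

theorem baseEnergy_config (t : ℕ → Fin 42) : baseEnergy (config n t) = totalEnergy n t := by
  simp only [baseEnergy, totalEnergy, ← Fin.sum_univ_eq_sum_range (fun i =>
    stateEnergy i (t i) - stateEnergy i 0), ← Fin.sum_univ_eq_sum_range (fun k =>
    stateCoupling k (t (k + 1)) (t k))]
  congr 1
  · exact sum_congr rfl fun i _ => ringEnergy_ring i (t i)
  · exact sum_congr rfl fun k _ => couplingEnergy_couplings k _ _

theorem energy_config (K : ℤ) (t : ℕ → Fin 42) :
    (slotSystem n).energy (slotWeight fields walls couplings K) (config n t) =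
      totalEnergy n t := by
  rw [energy_eq_baseEnergy, baseEnergy_config, sum_eq_zero, mul_zero, add_zero]
  exact fun i _ => wallExcess_ring (t i)

/-- The change of the energy when ring `i` changes its state to `v`. -/
def moveEnergy (n : ℕ) (t : ℕ → Fin 42) (i : ℕ) (v : Fin 42) : ℤ :=
  stateEnergy i v - stateEnergy i (t i) +
    (if 0 < i then stateCoupling (i - 1) v (t (i - 1)) -
      stateCoupling (i - 1) (t i) (t (i - 1)) else 0) +
    if i < n then stateCoupling i (t (i + 1)) v - stateCoupling i (t (i + 1)) (t i) else 0

theorem totalEnergy_update (t : ℕ → Fin 42) {i : ℕ} (hi : i ≤ n) (v : Fin 42) :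
    totalEnergy n (Function.update t i v) = totalEnergy n t + moveEnergy n t i v := by
  rw [← sub_eq_iff_eq_add']
  have h1 : ∀ j, (stateEnergy j (Function.update t i v j) - stateEnergy j 0) -
      (stateEnergy j (t j) - stateEnergy j 0) =
      if i = j then stateEnergy i v - stateEnergy i (t i) else 0 := by
    intro j
    split_ifs with h
    · subst h
      rw [Function.update_self]
      ring
    · rw [Function.update_of_ne (Ne.symm h)]
      ring
  have h2 : ∀ k, stateCoupling k (Function.update t i v (k + 1)) (Function.update t i v k) -
      stateCoupling k (t (k + 1)) (t k) =
      (if i = k + 1 then stateCoupling k v (t k) - stateCoupling k (t (k + 1)) (t k) else 0) +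
      if i = k then stateCoupling i (t (i + 1)) v - stateCoupling i (t (i + 1)) (t i) else 0 := by
    intro k
    by_cases h3 : i = k + 1
    · subst h3
      rw [Function.update_self, Function.update_of_ne (by omega), if_pos rfl, if_neg (by omega),
        add_zero]
    · rw [Function.update_of_ne (Ne.symm h3), if_neg h3, zero_add]
      split_ifs with h
      · subst h
        rw [Function.update_self]
      · rw [Function.update_of_ne (Ne.symm h), sub_self]
  have h4 : (∑ k ∈ range n, if i = k + 1 then stateCoupling k v (t k) -
      stateCoupling k (t (k + 1)) (t k) else 0) = if 0 < i then stateCoupling (i - 1) v (t (i - 1)) -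
      stateCoupling (i - 1) (t i) (t (i - 1)) else 0 := by
    cases i with
    | zero => simp
    | succ i =>
      simp only [add_left_inj, sum_ite_eq, mem_range, Nat.zero_lt_succ, if_true,
        Nat.add_sub_cancel]
      rw [if_pos (by omega)]
  rw [totalEnergy, totalEnergy, add_sub_add_comm, ← sum_sub_distrib, ← sum_sub_distrib]
  simp_rw [h1, h2]
  rw [sum_add_distrib, h4, sum_ite_eq, sum_ite_eq, moveEnergy, if_pos (by simpa using by omega)]
  simp only [mem_range]
  ring

/-- Writing the height of the ring above as `2 * height i + 42` makes all contributions affine in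
the single quantity `height i`. -/
theorem moveEnergy_succ (t : ℕ → Fin 42) (i : ℕ) : moveEnergy n t i (t i + 1) =
    atHeight i (ownStep (upper i) (t i) +
      (if 0 < i then lowerStep (t i) (t (i - 1)) else 0) +
      if i < n then upperStep (upper i) (t (i + 1)) (t i) else 0) := by
  have h1 : stateEnergy i (t i + 1) - stateEnergy i (t i) =
      atHeight i (ownStep (upper i) (t i)) := by
    have := ind_upper_mul_height i
    simp only [stateEnergy, atHeight, ownStep]
    linear_combination (descents (t i + 1) - descents (t i)) * this
  have h2 : (if 0 < i then stateCoupling (i - 1) (t i + 1) (t (i - 1)) -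
      stateCoupling (i - 1) (t i) (t (i - 1)) else 0) =
      atHeight i (if 0 < i then lowerStep (t i) (t (i - 1)) else 0) := by
    split_ifs with h
    · rw [stateCoupling, stateCoupling, Nat.sub_add_cancel h]
      simp only [atHeight, lowerStep]
      ring
    · simp [atHeight]
  have h3 : (if i < n then stateCoupling i (t (i + 1)) (t i + 1) -
      stateCoupling i (t (i + 1)) (t i) else 0) =
      atHeight i (if i < n then upperStep (upper i) (t (i + 1)) (t i) else 0) := by
    split_ifs with h
    · have := ind_upper_mul_height i
      simp only [stateCoupling, atHeight, upperStep, height_succ]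
      linear_combination (-2 * (coupling couplingSlope (t (i + 1)) (t i + 1) -
        coupling couplingSlope (t (i + 1)) (t i))) * this
    · simp [atHeight]
  rw [moveEnergy, h1, h2, h3, ← atHeight_add, ← atHeight_add]

end RingTower

/-! ### The invariant and the absence of dead ends -/

namespace RingTower

/-- The change of the energy by a step of ring `i`, as the coefficients of an affine function of its
height. -/
def stepPair (n : ℕ) (t : ℕ → Fin 42) (i : ℕ) : ℤ × ℤ :=
  ownStep (upper i) (t i) + (if 0 < i then lowerStep (t i) (t (i - 1)) else 0) +
    if i < n then upperStep (upper i) (t (i + 1)) (t i) else 0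

/-- The states that occur during an execution. -/
def Valid (n : ℕ) (t : ℕ → Fin 42) : Prop :=
  -- In state 19 the top ring could fall back to 18 and gain its whole barrier at once.
  (∀ k < n, compat (t (k + 1)) (t k) = true) ∧ t n ≠ 19

variable {n : ℕ} {t : ℕ → Fin 42} {i : ℕ}

theorem upper_eq_true (h : 0 < i) : upper i = true := decide_eq_true h

theorem Valid.compat_lower (h : Valid n t) (hi : i ≤ n) (h0 : 0 < i) :
    compat (t i) (t (i - 1)) = true := by
  have := h.1 (i - 1) (by omega)
  rwa [Nat.sub_add_cancel h0] at this

theorem Valid.update (h : Valid n t) {v : Fin 42}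
    (h1 : 0 < i → compat v (t (i - 1)) = true) (h2 : i < n → compat (t (i + 1)) v = true)
    (h3 : i = n → v ≠ 19) : Valid n (Function.update t i v) := by
  constructor
  · intro k hk
    by_cases hki : k = i
    · subst hki
      rw [Function.update_self, Function.update_of_ne (by omega)]
      exact h2 hk
    · rw [Function.update_of_ne hki]
      by_cases hki' : k + 1 = i
      · subst hki'
        rw [Function.update_self]
        exact h1 (by omega)
      · rw [Function.update_of_ne hki']
        exact h.1 k hk
  · by_cases hin : i = n
    · subst hin
      rw [Function.update_self]
      exact h3 rfl
    · rw [Function.update_of_ne (Ne.symm hin)]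
      exact h.2

theorem atHeight_ownStep (s : Fin 42) (hs : touchesLower s = true → i = 0) (h18 : s ≠ 18) :
    atHeight i (ownStep (upper i) s) = -1 := by
  obtain ⟨h1, h2⟩ := (ownStep_cases (upper i) s fun h => by rw [hs h]; rfl).1 h18
  rw [atHeight, h1]
  rcases Nat.eq_zero_or_pos i with rfl | hi
  · rw [height_zero, mul_zero, add_zero]
  · rw [h2 (upper_eq_true hi), zero_mul, add_zero]

theorem succ_ne_nineteen : ∀ s : Fin 42, s ≠ 18 → s + 1 ≠ 19 := by decide

theorem ne_of_touchesUpper {s : Fin 42} (h : touchesUpper s = false) : s ≠ 18 := by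
  rintro rfl
  exact absurd h (by decide)

theorem touchesLower_eq_false {s : Fin 42} (h : touchesUpper s = true) : touchesLower s = false := by
  by_contra h'
  rw [touchesUpper_eq_false s (by simpa using h')] at h
  exact Bool.noConfusion h

theorem stepPair_of_touchesUpper_eq_false (h : touchesUpper (t i) = false) :
    stepPair n t i =
      ownStep (upper i) (t i) + if 0 < i then lowerStep (t i) (t (i - 1)) else 0 := by
  simp [stepPair, upperStep_eq_zero _ _ _ h]

theorem stepPair_of_touchesLower_eq_false (h : touchesLower (t i) = false) :
    stepPair n t i =
      ownStep (upper i) (t i) + if i < n then upperStep (upper i) (t (i + 1)) (t i) else 0 := by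
  simp [stepPair, lowerStep_eq_zero _ _ h]

/-- A step of a ring lowers the energy by one or does not lower it. -/
theorem Valid.step (h : Valid n t) (hi : i ≤ n) :
    (atHeight i (stepPair n t i) = -1 ∧ Valid n (Function.update t i (t i + 1))) ∨
      0 ≤ stepPair n t i := by
  cases hu : touchesUpper (t i) with
  | false =>
    have h18 := ne_of_touchesUpper hu
    have h2 : i < n → compat (t (i + 1)) (t i + 1) = true := fun hin =>
      compat_of_touchesUpper_eq_false _ _ hu (h.1 i hin)
    rw [stepPair_of_touchesUpper_eq_false hu]
    rcases Nat.eq_zero_or_pos i with h0 | h0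
    · left
      subst h0
      refine ⟨?_, h.update (fun h0 => absurd h0 (lt_irrefl 0)) h2 fun _ => succ_ne_nineteen _ h18⟩
      rw [if_neg (lt_irrefl 0), add_zero]
      exact atHeight_ownStep (t 0) (fun _ => rfl) h18
    · rw [if_pos h0, upper_eq_true h0]
      rcases lower_cases _ _ hu (h.compat_lower hi h0) with ⟨h3, h4⟩ | h3
      · left
        rw [h3]
        exact ⟨by simp [atHeight], h.update (fun _ => h4) h2 fun _ => succ_ne_nineteen _ h18⟩
      · exact Or.inr h3
  | true =>
    have hl := touchesLower_eq_false hu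
    have h1 : 0 < i → compat (t i + 1) (t (i - 1)) = true := fun h0 =>
      compat_of_touchesUpper _ _ hu (h.compat_lower hi h0)
    rw [stepPair_of_touchesLower_eq_false hl]
    rcases hi.lt_or_eq with hin | hin
    · rw [if_pos hin]
      rcases upper_cases (upper i) _ _ hu (h.1 i hin) with ⟨h3, h4⟩ | h3
      · left
        rw [h3]
        exact ⟨by simp [atHeight], h.update h1 (fun _ => h4) fun h => absurd h hin.ne⟩
      · exact Or.inr h3
    · rw [if_neg hin.not_lt, add_zero]
      -- Nothing lifts the top ring over its barrier.
      by_cases h18 : t i = 18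
      · right
        exact (ownStep_cases (upper i) (t i) fun h => by
          rw [hl] at h; exact Bool.noConfusion h).2 h18
      · left
        refine ⟨atHeight_ownStep _ (fun h => by rw [hl] at h; exact Bool.noConfusion h) h18, ?_⟩
        exact h.update h1 (fun h => absurd hin h.ne) fun _ => succ_ne_nineteen _ h18

/-- A step backwards does not lower the energy. -/
theorem Valid.back (h : Valid n t) (hi : i ≤ n) :
    totalEnergy n t ≤ totalEnergy n (Function.update t i (t i - 1)) := by
  -- The backward step is the reverse of a forward step from `t'`, which need not be valid.
  set t' := Function.update t i (t i - 1) with ht'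
  have h1 : t' i + 1 = t i := by rw [ht', Function.update_self, sub_add_cancel]
  have h2 : Function.update t' i (t' i + 1) = t := by
    rw [h1, ht', Function.update_idem, Function.update_eq_self]
  have h3 : 0 < i → t' (i - 1) = t (i - 1) := fun h0 => Function.update_of_ne (by omega) ..
  have h4 : t' (i + 1) = t (i + 1) := Function.update_of_ne (by omega) ..
  have h5 := totalEnergy_update (n := n) t' hi (t' i + 1)
  rw [h2, moveEnergy_succ] at h5
  suffices atHeight i (stepPair n t' i) ≤ 0 by
    rw [stepPair] at this
    linarith
  cases hu : touchesUpper (t' i) with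
  | false =>
    rw [stepPair_of_touchesUpper_eq_false hu]
    rcases Nat.eq_zero_or_pos i with h0 | h0
    · subst h0
      rw [if_neg (lt_irrefl 0), add_zero,
        atHeight_ownStep (t' 0) (fun _ => rfl) (ne_of_touchesUpper hu)]
      norm_num
    · rw [if_pos h0, upper_eq_true h0, h3 h0]
      apply atHeight_nonpos
      apply lower_back _ _ hu
      rw [h1]
      exact h.compat_lower hi h0
  | true =>
    have hl := touchesLower_eq_false hu
    rw [stepPair_of_touchesLower_eq_false hl]
    rcases hi.lt_or_eq with hin | hin
    · rw [if_pos hin, h4]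
      apply atHeight_nonpos
      apply upper_back _ _ _ hu
      rw [h1]
      exact h.1 i hin
    · rw [if_neg hin.not_lt, add_zero, atHeight_ownStep _ (fun h => by
        rw [hl] at h; exact Bool.noConfusion h)]
      · norm_num
      · intro h18
        rw [h18] at h1
        apply h.2
        rw [← hin, ← h1]
        rfl

theorem not_nonneg_ownStep {κ : Bool} {s : Fin 42} (hs : touchesLower s = true → κ = false)
    (h18 : s ≠ 18) : ¬ 0 ≤ ownStep κ s := by
  intro h
  have h1 := ((ownStep_cases κ s hs).1 h18).1
  have h2 := h.1
  rw [h1] at h2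
  exact absurd h2 (by norm_num)

/-- If no ring can make a step, all rings are in state `18`. -/
theorem eq_of_stuck (h : Valid n t) (hs : ∀ i ≤ n, 0 ≤ stepPair n t i) : ∀ i ≤ n, t i = 18 := by
  -- Upwards through the tower: no ring is waiting for the one below.
  have hlow : ∀ i ≤ n, touchesLower (t i) = false := by
    intro i
    induction i with
    | zero =>
      intro hi
      by_contra hl
      have hl' : touchesLower (t 0) = true := by simpa using hl
      have hu := touchesUpper_eq_false _ hl'
      have h1 := hs 0 hi
      rw [stepPair_of_touchesUpper_eq_false hu, if_neg (lt_irrefl 0), add_zero] at h1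
      exact not_nonneg_ownStep (fun _ => rfl) (ne_of_touchesUpper hu) h1
    | succ i ih =>
      intro hi
      by_contra hl
      have hl' : touchesLower (t (i + 1)) = true := by simpa using hl
      have hu := touchesUpper_eq_false _ hl'
      have h1 := hs (i + 1) hi
      rw [stepPair_of_touchesUpper_eq_false hu, if_pos i.succ_pos,
        upper_eq_true i.succ_pos] at h1
      have h2 := hs i (by omega)
      rw [stepPair_of_touchesLower_eq_false (ih (by omega)), if_pos (by omega)] at h2
      exact not_lower_stuck (upper i) _ _ (ih (by omega)) (h.1 i (by omega)) h2 hl' h1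
  -- Downwards from the top: each ring is stopped by its own barrier.
  have main : ∀ k i, i + k = n → t i = 18 := by
    intro k
    induction k with
    | zero =>
      intro i hi
      by_contra h18
      have h1 := hs i (by omega)
      rw [stepPair_of_touchesLower_eq_false (hlow i (by omega)), if_neg (by omega), add_zero] at h1
      refine not_nonneg_ownStep (fun h' => ?_) h18 h1
      rw [hlow i (by omega)] at h'
      exact Bool.noConfusion h'
    | succ k ih =>
      intro i hi
      have h1 : t (i + 1) = 18 := ih (i + 1) (by omega)
      have h2 := hs i (by omega)
      rw [stepPair_of_touchesLower_eq_false (hlow i (by omega)), if_pos (by omega), h1] at h2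
      have h3 := h.1 i (by omega)
      rw [h1] at h3
      exact eq_of_upper_stuck _ _ (hlow i (by omega)) h3 h2
  exact fun i hi => main (n - i) i (by omega)

end RingTower

/-! ### The initial tour and the exponential bound -/

namespace RingTower

variable {n : ℕ}

theorem update_config (t : ℕ → Fin 42) (i : Fin (n + 1)) (j : Fin 21) (v : Bool)
    (i' : Fin (n + 1)) : (fun j' => Function.update (config n t) (i, j) v (i', j')) =
      if i' = i then Function.update (ring (t i)) j v else ring (t i') := by
  funext j'
  by_cases hi : i' = i
  · subst hi
    rw [if_pos rfl]
    by_cases hj : j' = j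
    · subst hj
      rw [Function.update_self, Function.update_self]
    · rw [Function.update_of_ne (by simpa using hj), Function.update_of_ne hj]
      rfl
  · rw [if_neg hi, Function.update_of_ne (by simp [hi])]
    rfl

theorem update_config_eq {t : ℕ → Fin 42} {i : Fin (n + 1)} {j : Fin 21} {s : Fin 42}
    (h : Function.update (ring (t i)) j (!ring (t i) j) = ring s) :
    Function.update (config n t) (i, j) (!config n t (i, j)) =
      config n (Function.update t i s) := by
  funext ⟨i', j'⟩
  have h1 := congrFun (update_config t i j (!ring (t i) j) i') j'
  change Function.update (config n t) (i, j) (!ring (t i) j) (i', j') = _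
  rw [h1]
  simp only [config]
  by_cases hi : i' = i
  · rw [if_pos hi, hi, Function.update_self, h]
  · rw [if_neg hi, Function.update_of_ne fun h' => hi (Fin.ext h')]

/-- The initial states. -/
def start (n : ℕ) : ℕ → Fin 42 := Function.update (fun _ => 18) n 20

theorem valid_start (n : ℕ) : Valid n (start n) := by
  constructor
  · intro k hk
    rw [start, Function.update_of_ne hk.ne]
    rcases eq_or_ne (k + 1) n with h | h
    · rw [← h, Function.update_self]
      decide
    · rw [Function.update_of_ne h]
      decide
  · rw [start, Function.update_self]
    decide

/-- The top ring has 40 unit steps and two descents ahead of it; all other rings rest at their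
barriers. -/
theorem totalEnergy_start (n : ℕ) :
    totalEnergy n (start n) = totalEnergy n (fun _ => 18) + (40 + 2 * height n) := by
  have h1 : ∀ J, coupling J 20 18 = 0 ∧ coupling J 18 18 = 0 := fun J => ⟨rfl, rfl⟩
  have h2 : bump 20 = 0 ∧ bump 18 = 0 ∧ descents 20 = 0 ∧ descents 18 = 2 ∧ phase 20 = 1 ∧
    phase 18 = 41 := by decide
  obtain ⟨b1, b2, d1, d2, p1, p2⟩ := h2
  rw [start, totalEnergy_update _ le_rfl, moveEnergy, if_neg (lt_irrefl n)]
  simp only [stateCoupling, (h1 _).1, (h1 _).2, stateEnergy, b1, b2, d1, d2, p1, p2]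
  simp
  ring

/-- There are finitely many configurations, so one price exceeds all energy differences. -/
theorem exists_wall_price (n : ℕ) : ∃ K : ℤ, 0 ≤ K ∧ ∀ σ σ' : Fin (n + 1) × Fin 21 → Bool,
    baseEnergy σ ≤ baseEnergy σ' + K := by
  have h : ∀ σ : Fin (n + 1) × Fin 21 → Bool, |baseEnergy σ| ≤ ∑ σ', |baseEnergy σ'| := fun σ =>
    single_le_sum (f := fun σ => |baseEnergy σ|) (fun _ _ => abs_nonneg _) (mem_univ σ)
  refine ⟨2 * ∑ σ' : Fin (n + 1) × Fin 21 → Bool, |baseEnergy σ'|, ?_, fun σ σ' => ?_⟩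
  · exact mul_nonneg (by norm_num) (sum_nonneg fun _ _ => abs_nonneg _)
  · have h1 := (abs_le.1 (h σ)).2
    have h2 := (abs_le.1 (h σ')).1
    linarith

theorem exists_tspInstance {R : Type} [AddCommMonoid R] [LinearOrder R] {φ : ℤ →+ R}
    (hφ : StrictMono φ) (n : ℕ) : ∃ I : TSPInstance R, I.IsMetric ∧
      Fintype.card I.V = 63 * (n + 1) + 42 ∧
      ∃ s : (tspTwoHalfOpt R).Sol I, ∀ l x, (tspTwoHalfOpt R).IsExecution I s l x →
        40 + 2 * height n ≤ l := by
  obtain ⟨K, hK0, hK⟩ := exists_wall_price n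
  let f := slotWeight (n := n) fields walls couplings K
  have hstep : ∀ σ τ, (∃ t, σ = config n t ∧ Valid n t) →
      (slotSystem n).energy f (Function.update σ τ (!σ τ)) < (slotSystem n).energy f σ →
      (∃ t, Function.update σ τ (!σ τ) = config n t ∧ Valid n t) ∧
        (slotSystem n).energy f σ - 1 ≤ (slotSystem n).energy f (Function.update σ τ (!σ τ)) := by
    rintro _ ⟨i, j⟩ ⟨t, rfl, ht⟩ hlt
    have hi : i.val ≤ n := Nat.lt_succ_iff.1 i.isLt
    rcases ring_succ (t i) j with h | h | h
    · rw [update_config_eq h] at hlt ⊢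
      rw [energy_config, energy_config, totalEnergy_update _ hi, moveEnergy_succ] at *
      rcases ht.step hi with ⟨h1, h2⟩ | h1
      · refine ⟨⟨_, rfl, h2⟩, ?_⟩
        rw [stepPair] at h1
        linarith
      · have := atHeight_nonneg i h1
        rw [stepPair] at this
        linarith
    · rw [update_config_eq h, energy_config, energy_config] at hlt
      exact absurd hlt (not_lt.2 (ht.back hi))
    -- A surplus wall costs at least `K`, more than the rest of the energy can gain.
    · exfalso
      rw [energy_config, energy_eq_baseEnergy, ← baseEnergy_config] at hlt
      have h1 : ∑ i' : Fin (n + 1), wallExcess (fun j' =>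
          Function.update (config n t) (i, j) (!config n t (i, j)) (i', j')) =
          wallExcess (Function.update (ring (t i)) j (!ring (t i) j)) := by
        simp_rw [update_config]
        rw [sum_eq_single i]
        · rw [if_pos rfl]
          rfl
        · intro i' _ hi'
          rw [if_neg hi', wallExcess_ring]
        · simp
      rw [h1] at hlt
      have h2 := mul_le_mul_of_nonneg_left h hK0
      have h3 := hK (config n t) (Function.update (config n t) (i, j) (!config n t (i, j)))
      linarith
  have hstuck : ∀ σ, (∃ t, σ = config n t ∧ Valid n t) →
      (∀ τ, (slotSystem n).energy f σ ≤ (slotSystem n).energy f (Function.update σ τ (!σ τ))) →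
      (slotSystem n).energy f σ ≤ totalEnergy n fun _ => 18 := by
    rintro _ ⟨t, rfl, ht⟩ hopt
    have hstuck := eq_of_stuck ht fun i hi => by
      rcases ht.step hi with ⟨h1, -⟩ | h1
      · exfalso
        obtain ⟨j, hj⟩ := exists_flip_ring (t i)
        have h2 := hopt (⟨i, by omega⟩, j)
        rw [update_config_eq (i := ⟨i, by omega⟩) hj, energy_config, energy_config,
          totalEnergy_update _ hi, moveEnergy_succ] at h2
        rw [stepPair] at h1
        linarith
      · exact h1
    rw [energy_config]
    apply le_of_eq
    simp only [totalEnergy]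
    congr 1
    · exact sum_congr rfl fun i hi => by rw [hstuck i (by simpa [Nat.lt_succ_iff] using hi)]
    · refine sum_congr rfl fun k hk => ?_
      have := mem_range.1 hk
      rw [hstuck k (by omega), hstuck (k + 1) (by omega)]
  obtain ⟨I, hI, hcard, s, hs⟩ := (slotSystem n).exists_instance hφ f
    (fun σ => ∃ t, σ = config n t ∧ Valid n t) ⟨start n, rfl, valid_start n⟩
    (totalEnergy n fun _ => 18) hstep hstuck
  refine ⟨I, hI, ?_, s, fun l x hx => ?_⟩
  · rw [hcard]
    simp only [Fintype.card_prod, Fintype.card_fin]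
    ring
  · have := hs l x hx
    rw [energy_config, totalEnergy_start] at this
    linarith

theorem exists_rate : ∃ c : ℝ, 1 < c ∧ c ^ 63 = 2 := by
  refine ⟨2 ^ (63⁻¹ : ℝ), Real.one_lt_rpow (by norm_num) (by norm_num), ?_⟩
  rw [← Real.rpow_natCast, ← Real.rpow_mul (by norm_num)]
  norm_num

/-- Each ring brings 63 vertices and doubles the running time; the 42 vertices of the extra level of
slots cost at most a factor 2. -/
theorem rate_le {c : ℝ} (h1 : 1 < c) (h2 : c ^ 63 = 2) (n l : ℕ) (h : 40 + 2 * height n ≤ l) :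
    1 * c ^ (63 * (n + 1) + 42) ≤ (l : ℝ) := by
  have h3 : c ^ 42 ≤ 2 := by
    rw [← h2]
    exact pow_le_pow_right₀ h1.le (by norm_num)
  have h4 : (40 + 2 * (42 * (2 ^ n - 1)) : ℝ) ≤ l := by
    have : ((40 + 2 * height n : ℤ) : ℝ) ≤ ((l : ℤ) : ℝ) := Int.cast_le.2 h
    simpa [height] using this
  have h5 : (1 : ℝ) ≤ 2 ^ n := one_le_pow₀ (by norm_num)
  calc 1 * c ^ (63 * (n + 1) + 42) = 2 ^ n * 2 * c ^ 42 := by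
        rw [pow_add, pow_mul, h2, pow_succ, one_mul]
    _ ≤ 2 ^ n * 2 * 2 := by gcongr
    _ ≤ l := by linarith

theorem allExp {R : Type} [AddCommMonoid R] [LinearOrder R] {φ : ℤ →+ R} (hφ : StrictMono φ) :
    (tspTwoHalfOpt R).AllExp ∧ (metricTspTwoHalfOpt R).AllExp := by
  obtain ⟨c, h1, h2⟩ := exists_rate
  refine ⟨⟨c, h1, 1, one_pos, fun m => ?_⟩, ⟨c, h1, 1, one_pos, fun m => ?_⟩⟩
  · obtain ⟨I, -, hcard, s, hs⟩ := exists_tspInstance hφ m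
    refine ⟨I, ?_, s, fun l x hx => ?_⟩
    · change m ≤ Fintype.card I.V
      omega
    · change 1 * c ^ Fintype.card I.V ≤ _
      rw [hcard]
      exact rate_le h1 h2 m l (hs l x hx)
  · obtain ⟨I, hI, hcard, s, hs⟩ := exists_tspInstance hφ m
    refine ⟨⟨I, hI⟩, ?_, s, fun l x hx => ?_⟩
    · change m ≤ Fintype.card I.V
      omega
    · change 1 * c ^ Fintype.card I.V ≤ _
      rw [hcard]
      exact rate_le h1 h2 m l (hs l x hx)

end RingTower

theorem theorem2 :
    ((tspTwoHalfOpt ℝ).AllExp ∧ (metricTspTwoHalfOpt ℝ).AllExp) ∧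
      ((tspTwoHalfOpt ℤ).AllExp ∧ (metricTspTwoHalfOpt ℤ).AllExp) :=
  ⟨RingTower.allExp (φ := Int.castAddHom ℝ) Int.cast_strictMono,
    RingTower.allExp (φ := AddMonoidHom.id ℤ) strictMono_id⟩
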